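/- Let $\Omega\subset\mathbb R^n$ be a bounded, open, connected (nonempty) set with $C^1$ boundary $\Gamma=\partial\Omega$ and outer unit normal $\nu$. Let $H\colon\overline\Omega\times\mathbb R^n\to\mathbb R$, $\gamma\colon\Gamma\to\mathbb R^n$ and $g\colon\Gamma\to\mathbb R$ be continuous. Assume that for every $x\in\overline\Omega$ the function $H(x,\cdot)$ is convex and $H(x,p)\to\infty$ as $|p|\to\infty$, and that $\nu(x)\cdot\gamma(x)>0$ for every $x\in\Gamma$. Put $L(x,\xi)=\sup_{p\in\mathbb R^n}(\xi\cdot p-H(x,p))\in\mathbb R\cup\{\infty\}$. For $x\in\overline\Omega$ let $\mathrm{SP}(x)$ be the set of triples $(\eta,v,l)$ of functions on $[0,\infty)$ with values in $\mathbb R^n$, $\mathbb R^n$ and $\mathbb R$ such that $\eta$ is absolutely continuous and $v,l$ are integrable on every bounded interval, $\eta(0)=x$, $\eta(t)\in\overline\Omega$ for all $t\ge 0$, and for almost every $t\ge 0$: $\dot\eta(t)+l(t)\gamma(\eta(t))=v(t)$, $l(t)\ge 0$, and $l(t)=0$ if $\eta(t)\in\Omega$. (The products $l(t)\gamma(\eta(t))$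 and $g(\eta(t))l(t)$ are understood as $0$ when $\eta(t)\in\Omega$.) Let $\phi\colon\overline\Omega\to\mathbb R$ be Lipschitz continuous and a viscosity solution of $H(x,D\phi)=0$ in $\Omega$, $\gamma\cdot D\phi=g$ on $\Gamma$; that is, for every $\psi\in C^1(\mathbb R^n)$ and $x\in\overline\Omega$: if $\phi-\psi$ attains its maximum (respectively, minimum) over $\overline\Omega$ at $x$, then $H(x,D\psi(x))\le 0$ (respectively, $\ge 0$) when $x\in\Omega$, and $H(x,D\psi(x))\le 0$ or $\gamma(x)\cdot D\psi(x)\le g(x)$ (respectively, $H(x,D\psi(x))\ge 0$ or $\gamma(x)\cdot D\psi(x)\ge g(x)$) when $x\in\Gamma$. Then for every $x\in\overline\Omega$ there is a triple $(\eta,v,l)\in\mathrm{SP}(x)$ such that for every $t>0$ the function $s\mapsto L(\eta(s),-v(s))$ is finite almost everywhere and integrable on $(0,t)$, $s\mapsto g(\eta(s))l(s)$ is integrable on $(0,t)$, and $$\phi(x)-\phi(\eta(t))=\int_0^t\bigl(L(\eta(s),-v(s))+g(\eta(s))l(s)\bigr)\,ds .$$ Moreover, $\eta$ is Lipschitz continuous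 on $[0,\infty)$ and $v$, $l$ are essentially bounded on $(0,\infty)$. -/

import Mathlib

open MeasureTheory Set Filter Topology
open scoped NNReal ENNReal InnerProductSpace

noncomputable section

namespace NeumannHJ

/-- The Euclidean space `ℝⁿ`. -/
abbrev Space (n : ℕ) : Type := EuclideanSpace ℝ (Fin n)

variable {n : ℕ}

/-- `ψ` is a `C¹` defining function of `Ω` near the boundary point `z`: near `z` the function `ψ` is
`C¹`, the set `Ω` is `{ψ < 0}`, and `ψ z = 0`, `Dψ(z) ≠ 0`. -/
structure IsLocalDefiningFunction (Ω : Set (Space n)) (z : Space n) (ψ : Space n → ℝ) : Prop where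
  contDiffAt : ContDiffAt ℝ 1 ψ z
  eq_zero : ψ z = 0
  gradient_ne_zero : gradient ψ z ≠ 0
  mem_iff : ∀ᶠ y in 𝓝 z, (y ∈ Ω ↔ ψ y < 0)

/-- `Ω` has a `C¹` boundary (and lies locally on one side of it). -/
def HasC1Boundary (Ω : Set (Space n)) : Prop :=
  ∀ z ∈ frontier Ω, ∃ ψ : Space n → ℝ, IsLocalDefiningFunction Ω z ψ

/-- `ν` is the outer unit normal vector to `Ω` at the boundary point `z`, i.e. `Dψ(z) / |Dψ(z)|`
for a local defining function `ψ`. -/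
def IsOuterUnitNormal (Ω : Set (Space n)) (z ν : Space n) : Prop :=
  ∃ ψ : Space n → ℝ, IsLocalDefiningFunction Ω z ψ ∧ ν = (‖gradient ψ z‖)⁻¹ • gradient ψ z

/-- The vector field `γ` is oblique to the boundary of `Ω`: `ν(z) · γ(z) > 0` for `z ∈ ∂Ω`. -/
def IsOblique (Ω : Set (Space n)) (γ : Space n → Space n) : Prop :=
  ∀ z ∈ frontier Ω, ∀ ν : Space n, IsOuterUnitNormal Ω z ν → 0 < ⟪ν, γ z⟫_ℝ

/-- `u` is a continuous viscosity subsolution of `H(x, Du) = a` in `Ω`, `γ · Du = g` on `∂Ω`.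
As `u` is continuous, it equals its upper semicontinuous envelope. -/
structure IsSubsolution (Ω : Set (Space n)) (H : Space n → Space n → ℝ) (γ : Space n → Space n)
    (g : Space n → ℝ) (a : ℝ) (u : Space n → ℝ) : Prop where
  continuousOn : ContinuousOn u (closure Ω)
  interior_test : ∀ x ∈ Ω, ∀ ψ : Space n → ℝ, ContDiff ℝ 1 ψ →
    IsMaxOn (fun y => u y - ψ y) (closure Ω) x → H x (gradient ψ x) ≤ a
  boundary_test : ∀ x ∈ frontier Ω, ∀ ψ : Space n → ℝ, ContDiff ℝ 1 ψ →
    IsMaxOn (fun y => u y - ψ y) (closure Ω) x →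
      H x (gradient ψ x) ≤ a ∨ ⟪γ x, gradient ψ x⟫_ℝ ≤ g x

/-- `u` is a continuous viscosity supersolution of `H(x, Du) = a` in `Ω`, `γ · Du = g` on `∂Ω`.
As `u` is continuous, it equals its lower semicontinuous envelope. -/
structure IsSupersolution (Ω : Set (Space n)) (H : Space n → Space n → ℝ) (γ : Space n → Space n)
    (g : Space n → ℝ) (a : ℝ) (u : Space n → ℝ) : Prop where
  continuousOn : ContinuousOn u (closure Ω)
  interior_test : ∀ x ∈ Ω, ∀ ψ : Space n → ℝ, ContDiff ℝ 1 ψ →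
    IsMinOn (fun y => u y - ψ y) (closure Ω) x → a ≤ H x (gradient ψ x)
  boundary_test : ∀ x ∈ frontier Ω, ∀ ψ : Space n → ℝ, ContDiff ℝ 1 ψ →
    IsMinOn (fun y => u y - ψ y) (closure Ω) x →
      a ≤ H x (gradient ψ x) ∨ g x ≤ ⟪γ x, gradient ψ x⟫_ℝ

/-- `u` is a continuous viscosity solution of `H(x, Du) = a` in `Ω`, `γ · Du = g` on `∂Ω`. -/
def IsSolution (Ω : Set (Space n)) (H : Space n → Space n → ℝ) (γ : Space n → Space n)
    (g : Space n → ℝ) (a : ℝ) (u : Space n → ℝ) : Prop :=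
  IsSubsolution Ω H γ g a u ∧ IsSupersolution Ω H γ g a u

/-- The Lagrangian `L(x, ξ) = sup_p (ξ · p - H(x, p))`, with values in `ℝ ∪ {∞}`. -/
def lagrangian (H : Space n → Space n → ℝ) (x ξ : Space n) : EReal :=
  ⨆ p : Space n, ((⟪ξ, p⟫_ℝ - H x p : ℝ) : EReal)

/-- `(η, v, l) ∈ SP(x)`: the triple solves the Skorokhod problem in the closure of `Ω` with
reflection direction `γ` and initial point `x`. Only the values on `[0, ∞)` matter. -/
structure SP (Ω : Set (Space n)) (γ : Space n → Space n) (x : Space n)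
    (η v : ℝ → Space n) (l : ℝ → ℝ) : Prop where
  absolutelyContinuous : ∀ T : ℝ, 0 < T → AbsolutelyContinuousOnInterval η 0 T
  integrable_v : ∀ T : ℝ, 0 < T → IntegrableOn v (Icc 0 T)
  integrable_l : ∀ T : ℝ, 0 < T → IntegrableOn l (Icc 0 T)
  initial : η 0 = x
  mem_closure : ∀ t : ℝ, 0 ≤ t → η t ∈ closure Ω
  ode : ∀ᵐ t ∂(volume.restrict (Ici (0 : ℝ))), HasDerivAt η (v t - l t • γ (η t)) t
  nonneg : ∀ᵐ t ∂(volume.restrict (Ici (0 : ℝ))), 0 ≤ l t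
  eq_zero : ∀ᵐ t ∂(volume.restrict (Ici (0 : ℝ))), η t ∈ Ω → l t = 0

/-- The running cost `L(η(s), -v(s)) + g(η(s)) l(s)`, as a real number; it is meant to be used where
the Lagrangian is finite. -/
def runningCost (H : Space n → Space n → ℝ) (g : Space n → ℝ)
    (η v : ℝ → Space n) (l : ℝ → ℝ) (s : ℝ) : ℝ :=
  (lagrangian H (η s) (-v s)).toReal + g (η s) * l s

/-- The triple is calibrated for `φ`: for every `t > 0`,
`φ(η(0)) - φ(η(t)) = ∫₀ᵗ (L(η(s), -v(s)) + g(η(s)) l(s)) ds`. The integral of the Lagrangian counts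
as `∞` unless the Lagrangian is finite almost everywhere and integrable along the triple, so this is
a part of the claim. -/
def IsCalibrated (H : Space n → Space n → ℝ) (g φ : Space n → ℝ)
    (η v : ℝ → Space n) (l : ℝ → ℝ) : Prop :=
  ∀ t : ℝ, 0 < t →
    (∀ᵐ s ∂(volume.restrict (Icc 0 t)), lagrangian H (η s) (-v s) ≠ ⊤) ∧
    IntegrableOn (fun s => (lagrangian H (η s) (-v s)).toReal) (Icc 0 t) ∧
    IntegrableOn (fun s => g (η s) * l s) (Icc 0 t) ∧
    φ (η 0) - φ (η t) = ∫ s in (0 : ℝ)..t, runningCost H g η v l s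

end NeumannHJ

end

open MeasureTheory Set Filter Topology
open scoped NNReal ENNReal InnerProductSpace

noncomputable section

namespace NeumannHJ

/-! The supersolution property produces a trajectory along which `φ` drops by at least the cost. The
subsolution property forbids any larger drop along any reflected curve, so the two together force
equality.

Supersolution half. Let `x` minimise `φ + N‖y - ·‖²` over the closure, and put `p = 2N(y - x)`.
Either `H(x,p) ≥ 0`, or `x` lies on the boundary and `γ·p ≥ g`. For a subgradient `ξ` of `H(x,·)` at
`p` one has `L(x,ξ) = ξ·p - H(x,p)`, so the velocity `v = -ξ` and a rate `l` give `p·(v - lγ) +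
L(x,-v) + gl = -H(x,p) - l(γ·p - g)`. Replacing `g` by `g - ε` leaves room to make this nonpositive
with a bounded `l`; very large `p` occur only at the boundary, where they point outward, and then a
fixed reflection rate suffices (`IsSupersolution.exists_velocity`). An Euler scheme following these
velocities decreases the Moreau envelope up to a vanishing error.

The state carries `∫v`, `∫l` and the cost besides the position. The admissible velocities then form
a convex set with closed graph, and pointwise limits of states are again trajectories
(`exists_trajectory_of_approx`), so weak convergence of controls never has to be discussed. The
bound on `l` from the selection blows up as `ε → 0`. On a true trajectory, however, the velocity is
tangent to the boundary at contact times, and obliqueness bounds `l` by `|C|/c`, independently of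
`ε`. A second limit therefore removes `ε`.

Subsolution half. Where a reflected curve and `φ` along it have derivatives `w = v - lγ` and `d`,
`IsSubsolution.exists_le_along` yields `p` with `H(z,p) ≤ 0`, `p·w ≤ d` and, at the boundary, `p·γ ≤
g`, up to a small error. Pairing `p` with `-v` gives `-d ≤ L + gl`. Hence `φ` plus cost is constant
on the constructed trajectory, and its cost rate, being below every upper bound for `L + gl`, equals
`L + gl` almost everywhere. -/

variable {n : ℕ}

/-! ### Closure of differential inclusions under pointwise limits -/

/-- A Lipschitz function whose derivative is almost everywhere at most `c` increases at rate at
most `c`. -/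
theorem sub_le_of_ae_deriv_le {f : ℝ → ℝ} {K : ℝ≥0} (hf : LipschitzWith K f) {a b c : ℝ}
    (hab : a ≤ b) (h : ∀ᵐ t, t ∈ Ioc a b → deriv f t ≤ c) : f b - f a ≤ c * (b - a) := by
  have hac : AbsolutelyContinuousOnInterval f a b :=
    (hf.lipschitzOnWith (s := uIcc a b)).absolutelyContinuousOnInterval
  rw [← hac.integral_deriv_eq_sub]
  have h1 : ∫ t in a..b, deriv f t ≤ ∫ _t in a..b, c := by
    refine intervalIntegral.integral_mono_ae_restrict hab hac.intervalIntegrable_deriv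
      (by simp) ?_
    rw [Filter.EventuallyLE, ← restrict_Ioc_eq_restrict_Icc, ae_restrict_iff' measurableSet_Ioc]
    exact h
  refine h1.trans_eq ?_
  simp [mul_comm]

/-- A set-valued map with closed graph and values in a fixed compact set is upper semicontinuous,
tested on open half-spaces. -/
theorem eventually_forall_lt_of_isClosed_graph {E W : Type*} [TopologicalSpace E]
    [NormedAddCommGroup W] [NormedSpace ℝ W] {D : Set E} {F : E → Set W} {B : Set W}
    (hB : IsCompact B) (hFB : ∀ x ∈ D, F x ⊆ B)
    (hgraph : IsClosed {q : E × W | q.1 ∈ D ∧ q.2 ∈ F q.1}) {x₀ : E}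
    (f : W →L[ℝ] ℝ) (c : ℝ) (h : ∀ w ∈ F x₀, f w < c) :
    ∀ᶠ x in 𝓝[D] x₀, ∀ w ∈ F x, f w < c := by
  have key : ∀ᶠ x in 𝓝 x₀, ∀ w ∈ B, ¬ ((x, w) ∈ {q : E × W | q.1 ∈ D ∧ q.2 ∈ F q.1} ∧ c ≤ f w) := by
    refine hB.eventually_forall_of_forall_eventually fun w _ => ?_
    have hcl : IsClosed ({q : E × W | q.1 ∈ D ∧ q.2 ∈ F q.1} ∩ {q | c ≤ f q.2}) :=
      hgraph.inter (isClosed_le continuous_const (f.continuous.comp continuous_snd))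
    refine hcl.isOpen_compl.mem_nhds ?_
    rintro ⟨⟨-, h1⟩, h2⟩
    exact absurd (h w h1) (not_lt.2 h2)
  rw [eventually_nhdsWithin_iff]
  filter_upwards [key] with x hx hxD w hw
  by_contra hcw
  exact hx w (hFB x hxD hw) ⟨⟨hxD, hw⟩, not_lt.1 hcw⟩

/-- Limits of approximate trajectories of an upper semicontinuous, convex-valued differential
inclusion `Y' ∈ G (Y)` with `Y ∈ D` are trajectories. The values of `G` are tested by half-spaces,
and the limit is taken pointwise along an ultrafilter. -/
theorem exists_trajectory_of_approx {W : Type*} [NormedAddCommGroup W] [NormedSpace ℝ W]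
    [ProperSpace W] {D : Set W} (hD : IsClosed D) {G : W → Set W}
    (hconv : ∀ y ∈ D, Convex ℝ (G y)) (hclosed : ∀ y ∈ D, IsClosed (G y))
    (husc : ∀ y₀ ∈ D, ∀ (f : W →L[ℝ] ℝ) (c : ℝ), (∀ w ∈ G y₀, f w < c) →
      ∀ᶠ y in 𝓝[D] y₀, ∀ w ∈ G y, f w < c)
    (Y : ℕ → ℝ → W) (Y₀ : W) (M : ℝ≥0) (e : ℕ → ℝ) (he : Tendsto e atTop (𝓝 0))
    (hY0 : ∀ k t, t ≤ 0 → Y k t = Y₀)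
    (hlip : ∀ k s t, ‖Y k t - Y k s‖ ≤ M * |t - s| + e k)
    (hnear : ∀ t, 0 ≤ t → ∀ δ > 0, ∀ᶠ k in atTop, ∃ y ∈ D, ‖y - Y k t‖ ≤ δ)
    (hinc : ∀ (f : W →L[ℝ] ℝ) (c s t δ : ℝ), 0 ≤ s → s ≤ t → 0 < δ → ∀ᶠ k in atTop,
      (∀ τ ∈ Icc s t, ∀ y ∈ D, ‖y - Y k τ‖ ≤ δ → ∀ w ∈ G y, f w ≤ c) →
        f (Y k t - Y k s) ≤ c * (t - s) + δ) :
    ∃ Z : ℝ → W, LipschitzWith M Z ∧ (∀ t ≤ 0, Z t = Y₀) ∧ (∀ t, 0 ≤ t → Z t ∈ D) ∧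
      (∀ t, Tendsto (fun k => Y k t) (hyperfilter ℕ) (𝓝 (Z t))) ∧
      ∀ t, 0 < t → ∀ w, HasDerivAt Z w t → w ∈ G (Z t) := by
  -- One ultrafilter serves all times at once, which replaces an Arzelà–Ascoli extraction.
  have hU : (hyperfilter ℕ : Filter ℕ) ≤ atTop := by
    rw [← Nat.cofinite_eq_atTop]; exact hyperfilter_le_cofinite
  have he' : Tendsto e (hyperfilter ℕ) (𝓝 0) := he.mono_left hU
  have hex : ∀ t, ∃ z, Tendsto (fun k => Y k t) (hyperfilter ℕ) (𝓝 z) := by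
    intro t
    have hev : ∀ᶠ k in (hyperfilter ℕ : Filter ℕ),
        Y k t ∈ Metric.closedBall Y₀ (M * |t| + 1) := by
      filter_upwards [he'.eventually (ge_mem_nhds zero_lt_one)] with k hk
      rw [mem_closedBall_iff_norm, ← hY0 k 0 le_rfl]
      have := hlip k 0 t
      rw [sub_zero] at this
      linarith
    obtain ⟨z, -, hz⟩ := (isCompact_closedBall Y₀ (M * |t| + 1)).ultrafilter_le_nhds'
      ((hyperfilter ℕ).map fun k => Y k t) hev
    exact ⟨z, hz⟩
  choose Z hZ using hex
  have hZlip : ∀ s t, ‖Z t - Z s‖ ≤ M * |t - s| := by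
    intro s t
    have h1 := ((hZ t).sub (hZ s)).norm
    have h2 : Tendsto (fun k => M * |t - s| + e k) (hyperfilter ℕ) (𝓝 (M * |t - s| + 0)) :=
      he'.const_add _
    rw [add_zero] at h2
    exact le_of_tendsto_of_tendsto' h1 h2 fun k => hlip k s t
  have hZ0 : ∀ t ≤ 0, Z t = Y₀ := fun t ht =>
    tendsto_nhds_unique (hZ t) (by simp only [hY0 _ t ht]; exact tendsto_const_nhds)
  have hZD : ∀ t, 0 ≤ t → Z t ∈ D := by
    intro t ht
    rw [← hD.closure_eq, Metric.mem_closure_iff]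
    intro δ hδ
    obtain ⟨k, ⟨y, hyD, hy⟩, hk⟩ := (((hnear t ht (δ / 3) (by positivity)).filter_mono hU).and
      ((hZ t).eventually (Metric.ball_mem_nhds _ (show 0 < δ / 3 by positivity)))).exists
    refine ⟨y, hyD, ?_⟩
    have h1 : dist (Y k t) (Z t) < δ / 3 := hk
    have h2 : dist y (Y k t) ≤ δ / 3 := by rwa [dist_eq_norm]
    have := dist_triangle y (Y k t) (Z t)
    rw [dist_comm]
    linarith
  refine ⟨Z, LipschitzWith.of_dist_le_mul fun t s => ?_, hZ0, hZD, hZ, ?_⟩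
  · rw [dist_eq_norm, Real.dist_eq]; exact hZlip s t
  intro t ht w hw
  by_contra hwG
  -- Separate `w` from `G (Z t)`. By semicontinuity the half-space persists near `Z t`, so
  -- increments of `f ∘ Z` just after `t` have slope at most `c < f w`.
  obtain ⟨f, c, hfc, hcw⟩ := geometric_hahn_banach_closed_point (hconv _ (hZD t ht.le))
    (hclosed _ (hZD t ht.le)) hwG
  obtain ⟨r, hr, hball⟩ := Metric.mem_nhdsWithin_iff.1 (husc _ (hZD t ht.le) f c hfc)
  -- The radius `r` is shared in quarters: the distance from `y` to the approximation, its motion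
  -- during `s₀`, the error `e k`, and its distance to `Z t`.
  set s₀ : ℝ := r / (4 * (M + 1)) with hs₀
  have hs₀pos : 0 < s₀ := by positivity
  have hMs : M * s₀ ≤ r / 4 := by
    rw [hs₀]
    have : (M : ℝ) * (r / (4 * (M + 1))) = r / 4 * (M / (M + 1)) := by field_simp
    rw [this]
    have h1 : (M : ℝ) / (M + 1) ≤ 1 := by
      rw [div_le_one (by positivity)]; linarith [M.2]
    nlinarith
  have hincr : ∀ s ∈ Icc t (t + s₀), f (Z s - Z t) ≤ c * (s - t) := by
    intro s hs
    have hlim : Tendsto (fun k => f (Y k s - Y k t)) (hyperfilter ℕ) (𝓝 (f (Z s - Z t))) :=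
      (f.continuous.tendsto _).comp ((hZ s).sub (hZ t))
    refine le_of_forall_pos_le_add fun δ hδ => ?_
    set δ' := min δ (r / 4) with hδ'
    have hδ'pos : 0 < δ' := by positivity
    refine (le_of_tendsto hlim ?_ : f (Z s - Z t) ≤ c * (s - t) + δ)
    filter_upwards [(hinc f c t s δ' ht.le hs.1 hδ'pos).filter_mono hU,
      he'.eventually (gt_mem_nhds (show (0 : ℝ) < r / 4 by positivity)),
      (hZ t).eventually (Metric.ball_mem_nhds _ (show 0 < r / 4 by positivity))] with k hk1 hk2 hk3
    refine (hk1 fun τ hτ y hyD hy v hv => ?_).trans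
      (by linarith [min_le_left δ (r / 4)])
    refine (hball ⟨?_, hyD⟩ v hv).le
    have hd1 : dist (Y k t) (Z t) < r / 4 := hk3
    have hd2 : dist y (Y k τ) ≤ r / 4 := by
      rw [dist_eq_norm]; exact hy.trans (min_le_right _ _)
    have hd3 : dist (Y k τ) (Y k t) ≤ r / 4 + r / 4 := by
      rw [dist_eq_norm]
      refine (hlip k t τ).trans ?_
      have : |τ - t| ≤ s₀ := by
        rw [abs_of_nonneg (by linarith [hτ.1])]; linarith [hτ.2, hs.2]
      have := mul_le_mul_of_nonneg_left this M.2
      change (M : ℝ) * _ ≤ M * _ at this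
      linarith
    rw [Metric.mem_ball]
    linarith [dist_triangle4 y (Y k τ) (Y k t) (Z t)]
  have hder : HasDerivAt (fun s => f (Z s)) (f w) t := f.hasFDerivAt.comp_hasDerivAt t hw
  have hslope : Tendsto (slope (fun s => f (Z s)) t) (𝓝[>] t) (𝓝 (f w)) :=
    (hasDerivAt_iff_tendsto_slope.1 hder).mono_left
      (nhdsWithin_mono _ fun s (hs : t < s) => ne_of_gt hs)
  have : f w ≤ c := by
    refine le_of_tendsto hslope ?_
    filter_upwards [Ioc_mem_nhdsGT (show t < t + s₀ by linarith)] with s hs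
    rw [slope_def_field, div_le_iff₀ (by linarith [hs.1]), ← map_sub]
    exact hincr s ⟨hs.1.le, hs.2⟩
  linarith

/-! ### Geometry of the `C¹` boundary -/

section Geometry

variable {Ω : Set (Space n)} {z : Space n} {ψ : Space n → ℝ} {ν : Space n}

theorem IsLocalDefiningFunction.hasFDerivAt (h : IsLocalDefiningFunction Ω z ψ) :
    HasFDerivAt ψ (innerSL ℝ (gradient ψ z)) z :=
  (h.contDiffAt.differentiableAt (by norm_num)).hasGradientAt

theorem IsLocalDefiningFunction.eventually_continuousAt (h : IsLocalDefiningFunction Ω z ψ) :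
    ∀ᶠ y in 𝓝 z, ContinuousAt ψ y :=
  (h.contDiffAt.eventually (by simp)).mono fun _ hy => hy.continuousAt

theorem IsLocalDefiningFunction.eventually_nonpos (h : IsLocalDefiningFunction Ω z ψ) :
    ∀ᶠ y in 𝓝[closure Ω] z, ψ y ≤ 0 := by
  rw [eventually_nhdsWithin_iff]
  filter_upwards [h.mem_iff.eventually_nhds, h.eventually_continuousAt] with y hy hc hyΩ
  have hfreq : ∃ᶠ x in 𝓝 y, x ∈ Ω := mem_closure_iff_frequently.1 hyΩ
  by_contra hpos
  have hev : ∀ᶠ x in 𝓝 y, 0 < ψ x := hc.eventually (lt_mem_nhds (not_le.1 hpos))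
  obtain ⟨x, hx1, hx2, hx3⟩ := (hfreq.and_eventually (hev.and hy)).exists
  exact lt_asymm hx2 (hx3.1 hx1)

theorem IsLocalDefiningFunction.eventually_eq_zero (hΩ : IsOpen Ω)
    (h : IsLocalDefiningFunction Ω z ψ) : ∀ᶠ y in 𝓝[frontier Ω] z, ψ y = 0 := by
  have h1 := h.eventually_nonpos
  rw [eventually_nhdsWithin_iff] at h1 ⊢
  filter_upwards [h1, h.mem_iff] with y hy1 hy2 hy
  rw [hΩ.frontier_eq] at hy
  exact le_antisymm (hy1 hy.1) (not_lt.1 fun hlt => hy.2 (hy2.2 hlt))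

theorem continuousAt_gradient (h : ContDiffAt ℝ 1 ψ z) : ContinuousAt (gradient ψ) z := by
  have h1 : ContinuousAt (fderiv ℝ ψ) z :=
    (h.fderiv_right (m := 0) (by norm_num)).continuousAt
  exact (InnerProductSpace.toDual ℝ (Space n)).symm.continuous.continuousAt.comp h1

theorem IsLocalDefiningFunction.eventually_isLocalDefiningFunction (hΩ : IsOpen Ω)
    (h : IsLocalDefiningFunction Ω z ψ) :
    ∀ᶠ y in 𝓝[frontier Ω] z, IsLocalDefiningFunction Ω y ψ := by
  have h1 := h.eventually_eq_zero hΩ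
  rw [eventually_nhdsWithin_iff] at h1 ⊢
  filter_upwards [h1, h.mem_iff.eventually_nhds, h.contDiffAt.eventually (by simp),
    (continuousAt_gradient h.contDiffAt).eventually_ne h.gradient_ne_zero] with y hy1 hy2 hy3 hy4 hy
  exact ⟨hy3, hy1 hy, hy4, hy2⟩

theorem IsOuterUnitNormal.norm_eq_one (h : IsOuterUnitNormal Ω z ν) : ‖ν‖ = 1 := by
  obtain ⟨ψ, hψ, rfl⟩ := h
  rw [norm_smul, norm_inv, norm_norm, inv_mul_cancel₀ (norm_ne_zero_iff.2 hψ.gradient_ne_zero)]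

/-- First-order expansion of the defining function, which is nonpositive on the closure. Its
vanishing on the frontier gives the opposite estimate there; the pair controls the normal coordinate
of the maximum points in the subsolution argument. -/
theorem IsOuterUnitNormal.eventually_inner_le (h : IsOuterUnitNormal Ω z ν) {e : ℝ} (he : 0 < e) :
    ∀ᶠ y in 𝓝[closure Ω] z, ⟪ν, y - z⟫_ℝ ≤ e * ‖y - z‖ := by
  obtain ⟨ψ, hψ, rfl⟩ := h
  have hg : 0 < ‖gradient ψ z‖ := norm_pos_iff.2 hψ.gradient_ne_zero
  have h1 := (hψ.hasFDerivAt.isLittleO.bound (mul_pos he hg)).filter_mono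
    (nhdsWithin_le_nhds (s := closure Ω))
  filter_upwards [h1, hψ.eventually_nonpos] with y hy1 hy2
  rw [hψ.eq_zero, sub_zero, innerSL_apply_apply, Real.norm_eq_abs] at hy1
  rw [real_inner_smul_left, inv_mul_le_iff₀ hg]
  linarith [(abs_le.1 hy1).1]

theorem IsOuterUnitNormal.eventually_le_inner (hΩ : IsOpen Ω) (h : IsOuterUnitNormal Ω z ν)
    {e : ℝ} (he : 0 < e) : ∀ᶠ y in 𝓝[frontier Ω] z, -(e * ‖y - z‖) ≤ ⟪ν, y - z⟫_ℝ := by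
  obtain ⟨ψ, hψ, rfl⟩ := h
  have hg : 0 < ‖gradient ψ z‖ := norm_pos_iff.2 hψ.gradient_ne_zero
  have h1 := (hψ.hasFDerivAt.isLittleO.bound (mul_pos he hg)).filter_mono
    (nhdsWithin_le_nhds (s := frontier Ω))
  filter_upwards [h1, hψ.eventually_eq_zero hΩ] with y hy1 hy2
  rw [hψ.eq_zero, sub_zero, innerSL_apply_apply, Real.norm_eq_abs, hy2] at hy1
  rw [real_inner_smul_left, le_inv_mul_iff₀ hg]
  linarith [(abs_le.1 hy1).2]

/-- The defining function has negative slope along the ray, so inward directions are feasible for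
one-sided variations of a minimum point. -/
theorem IsOuterUnitNormal.eventually_mem (h : IsOuterUnitNormal Ω z ν) {e : Space n}
    (he : ⟪ν, e⟫_ℝ < 0) : ∀ᶠ t in 𝓝[>] (0 : ℝ), z + t • e ∈ Ω := by
  obtain ⟨ψ, hψ, rfl⟩ := h
  have hg : 0 < ‖gradient ψ z‖ := norm_pos_iff.2 hψ.gradient_ne_zero
  rw [real_inner_smul_left, inv_mul_lt_iff₀ hg, mul_zero] at he
  have hline : HasDerivAt (fun t : ℝ => z + t • e) e 0 := by
    simpa using ((hasDerivAt_id (0 : ℝ)).smul_const e).const_add z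
  have hz : z + (0 : ℝ) • e = z := by simp
  have hcomp : HasDerivAt (fun t : ℝ => ψ (z + t • e)) ⟪gradient ψ z, e⟫_ℝ 0 := by
    have := HasFDerivAt.comp_hasDerivAt (x := (0 : ℝ)) (f := fun t : ℝ => z + t • e)
      (l := ψ) (l' := innerSL ℝ (gradient ψ z)) (by rw [hz]; exact hψ.hasFDerivAt) hline
    exact this
  have hslope := (hasDerivAt_iff_tendsto_slope.1 hcomp).mono_left
    (nhdsWithin_mono _ fun s (hs : (0 : ℝ) < s) => ne_of_gt hs)
  have hmem : ∀ᶠ t in 𝓝[>] (0 : ℝ), (z + t • e ∈ Ω ↔ ψ (z + t • e) < 0) := by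
    have hc : Tendsto (fun t : ℝ => z + t • e) (𝓝[>] 0) (𝓝 z) := by
      have := hline.continuousAt.tendsto
      rw [hz] at this
      exact this.mono_left nhdsWithin_le_nhds
    exact hc.eventually hψ.mem_iff
  filter_upwards [hslope.eventually (gt_mem_nhds he), hmem, self_mem_nhdsWithin] with t h1 h2 h3
  have h3' : (0 : ℝ) < t := h3
  refine h2.2 ?_
  rw [slope_def_field, hz, hψ.eq_zero, sub_zero, sub_zero, div_lt_iff₀ h3', zero_mul] at h1
  exact h1

/-- The velocity of a curve in the closure of `Ω` is tangent to the boundary where it touches it. -/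
theorem IsOuterUnitNormal.inner_deriv_eq_zero {X : ℝ → Space n} {t : ℝ} {w : Space n}
    (h : IsOuterUnitNormal Ω (X t) ν) (hX : ∀ᶠ s in 𝓝 t, X s ∈ closure Ω)
    (hw : HasDerivAt X w t) : ⟪ν, w⟫_ℝ = 0 := by
  obtain ⟨ψ, hψ, rfl⟩ := h
  have hcomp : HasDerivAt (fun s => ψ (X s)) ⟪gradient ψ (X t), w⟫_ℝ t :=
    hψ.hasFDerivAt.comp_hasDerivAt t hw
  -- The curve stays in the closure on both sides of `t`, so `t` is a two-sided maximum and the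
  -- normal velocity vanishes instead of merely having a sign.
  have hmax : IsLocalMax (fun s => ψ (X s)) t := by
    have h1 : Tendsto X (𝓝 t) (𝓝[closure Ω] (X t)) :=
      tendsto_nhdsWithin_iff.2 ⟨hw.continuousAt, hX⟩
    filter_upwards [h1.eventually hψ.eventually_nonpos] with s hs
    rw [hψ.eq_zero]; exact hs
  rw [real_inner_smul_left, hmax.hasDerivAt_eq_zero hcomp, mul_zero]

/-- Obliqueness is uniform along the compact boundary. -/
theorem IsOblique.exists_pos_le {γ : Space n → Space n} (hΩ : IsOpen Ω)
    (hbdd : Bornology.IsBounded Ω) (hC1 : HasC1Boundary Ω) (hγ : ContinuousOn γ (frontier Ω))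
    (hobl : IsOblique Ω γ) :
    ∃ c > 0, ∀ x ∈ frontier Ω, ∃ ν, IsOuterUnitNormal Ω x ν ∧ c ≤ ⟪ν, γ x⟫_ℝ := by
  have hcomp : IsCompact (frontier Ω) :=
    Metric.isCompact_of_isClosed_isBounded isClosed_frontier
      (hbdd.closure.subset frontier_subset_closure)
  refine hcomp.induction_on (p := fun s => ∃ c > 0, ∀ x ∈ s, x ∈ frontier Ω →
    ∃ ν, IsOuterUnitNormal Ω x ν ∧ c ≤ ⟪ν, γ x⟫_ℝ) ⟨1, one_pos, by simp⟩ ?_ ?_ ?_ |>.imp ?_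
  · rintro s t hst ⟨c, hc, h⟩
    exact ⟨c, hc, fun x hx => h x (hst hx)⟩
  · rintro s t ⟨c, hc, h⟩ ⟨c', hc', h'⟩
    refine ⟨min c c', lt_min hc hc', ?_⟩
    rintro x (hx | hx) hxf
    · obtain ⟨ν, h1, h2⟩ := h x hx hxf
      exact ⟨ν, h1, (min_le_left _ _).trans h2⟩
    · obtain ⟨ν, h1, h2⟩ := h' x hx hxf
      exact ⟨ν, h1, (min_le_right _ _).trans h2⟩
  · intro z hz
    obtain ⟨ψ, hψ⟩ := hC1 z hz
    have hpos := hobl z hz _ ⟨ψ, hψ, rfl⟩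
    set N : Space n → Space n := fun y => (‖gradient ψ y‖)⁻¹ • gradient ψ y with hN
    have hgc := continuousAt_gradient hψ.contDiffAt
    have hNc : ContinuousAt N z :=
      (hgc.norm.inv₀ (norm_ne_zero_iff.2 hψ.gradient_ne_zero)).smul hgc
    have hic : ContinuousWithinAt (fun y => ⟪N y, γ y⟫_ℝ) (frontier Ω) z :=
      hNc.continuousWithinAt.inner (hγ z hz)
    have hev := (hic.eventually (lt_mem_nhds (half_lt_self hpos))).and
      (hψ.eventually_isLocalDefiningFunction hΩ)
    refine ⟨_, hev, _, half_pos hpos, ?_⟩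
    rintro x ⟨h1, h2⟩ -
    exact ⟨N x, ⟨ψ, h2, rfl⟩, h1.le⟩
  · rintro c ⟨hc, h⟩
    exact ⟨hc, fun x hx => h x hx hx⟩

end Geometry

/-! ### Quadratic test functions and subsolutions along curves -/

section TestFunction

variable (z a b c : Space n) (P : Space n →L[ℝ] Space n) (N κ : ℝ)

/-- A quadratic test function at `z` with gradient `a` at `z`. -/
def quadTest (y : Space n) : ℝ :=
  ⟪a, y - z⟫_ℝ + N * (‖P (y - z)‖ ^ 2 + ⟪c, y - z⟫_ℝ ^ 2 + κ * ⟪b, y - z⟫_ℝ ^ 2)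

/-- The gradient of `quadTest` at `z + u`. -/
def quadTestGrad (u : Space n) : Space n :=
  a + (2 * N) • (P.adjoint (P u) + ⟪c, u⟫_ℝ • c + (κ * ⟪b, u⟫_ℝ) • b)

theorem contDiff_quadTest : ContDiff ℝ 1 (quadTest z a b c P N κ) := by
  unfold quadTest
  have h : ContDiff ℝ 1 fun y : Space n => y - z := contDiff_id.sub contDiff_const
  have hin : ∀ v : Space n, ContDiff ℝ 1 fun y : Space n => ⟪v, y - z⟫_ℝ :=
    fun v => contDiff_const.inner ℝ h
  exact (hin a).add (contDiff_const.mul ((((P.contDiff.comp h).norm_sq ℝ).add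
    ((hin c).pow 2)).add (contDiff_const.mul ((hin b).pow 2))))

theorem gradient_quadTest (y : Space n) :
    gradient (quadTest z a b c P N κ) y = quadTestGrad a b c P N κ (y - z) := by
  refine HasGradientAt.gradient (hasGradientAt_iff_hasFDerivAt.2 ?_)
  unfold quadTest
  have h : HasFDerivAt (fun y : Space n => y - z) (ContinuousLinearMap.id ℝ (Space n)) y :=
    (hasFDerivAt_id y).sub_const z
  have hin : ∀ v : Space n, HasFDerivAt (fun y : Space n => ⟪v, y - z⟫_ℝ) (innerSL ℝ v) y :=
    fun v => (innerSL ℝ v).hasFDerivAt.comp y h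
  have hP : HasFDerivAt (fun y : Space n => P (y - z)) P y := P.hasFDerivAt.comp y h
  refine ((hin a).add (((hP.norm_sq.add ((hin c).pow 2)).add
    (((hin b).pow 2).const_mul κ)).const_mul N)).congr_fderiv ?_
  ext e
  simp [quadTestGrad, ContinuousLinearMap.adjoint_inner_left]
  ring

theorem inner_quadTestGrad (u e : Space n) :
    ⟪quadTestGrad a b c P N κ u, e⟫_ℝ = ⟪a, e⟫_ℝ +
      2 * N * (⟪P u, P e⟫_ℝ + ⟪c, u⟫_ℝ * ⟪c, e⟫_ℝ + κ * ⟪b, u⟫_ℝ * ⟪b, e⟫_ℝ) := by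
  simp [quadTestGrad, inner_add_left, real_inner_smul_left, ContinuousLinearMap.adjoint_inner_left]
  ring

/-- The bound depends on `N` only through `N * ‖u‖`, so gradients stay bounded at points within
`O(1/N)` of `z`. -/
theorem norm_quadTestGrad_le (hN : 0 ≤ N) (hκ : 0 ≤ κ) (u : Space n) :
    ‖quadTestGrad a b c P N κ u‖ ≤
      ‖a‖ + 2 * (‖P‖ ^ 2 + ‖c‖ ^ 2 + κ * ‖b‖ ^ 2) * (N * ‖u‖) := by
  have h1 : ‖P.adjoint (P u)‖ ≤ ‖P‖ ^ 2 * ‖u‖ := by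
    refine (P.adjoint.le_opNorm _).trans ?_
    rw [LinearIsometryEquiv.norm_map, sq, mul_assoc]
    exact mul_le_mul_of_nonneg_left (P.le_opNorm u) (norm_nonneg _)
  have h2 : ‖⟪c, u⟫_ℝ • c‖ ≤ ‖c‖ ^ 2 * ‖u‖ := by
    rw [norm_smul, Real.norm_eq_abs]
    nlinarith [abs_real_inner_le_norm c u, norm_nonneg c]
  have h3 : ‖(κ * ⟪b, u⟫_ℝ) • b‖ ≤ κ * ‖b‖ ^ 2 * ‖u‖ := by
    rw [norm_smul, norm_mul, Real.norm_eq_abs, Real.norm_eq_abs, abs_of_nonneg hκ]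
    have := mul_le_mul_of_nonneg_right (abs_real_inner_le_norm b u) (norm_nonneg b)
    nlinarith
  unfold quadTestGrad
  refine (norm_add_le _ _).trans ?_
  rw [norm_smul, Real.norm_eq_abs, abs_of_nonneg (by positivity)]
  have h4 := (norm_add₃_le (a := P.adjoint (P u)) (b := ⟪c, u⟫_ℝ • c) (c := (κ * ⟪b, u⟫_ℝ) • b))
  have := mul_le_mul_of_nonneg_left (h4.trans (add_le_add (add_le_add h1 h2) h3))
    (show 0 ≤ 2 * N by positivity)
  linarith

end TestFunction

theorem sq_add_add_le {x y z : ℝ} : (x + y + z) ^ 2 ≤ 3 * (x ^ 2 + y ^ 2 + z ^ 2) := by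
  nlinarith [sq_nonneg (x - y), sq_nonneg (y - z), sq_nonneg (x - z)]

/-- Subsolution property along a curve through `z` with velocity `w`, along which `φ` has
derivative `d`: there is a vector `p` in the sublevel set of `H z` which is compatible with `d` and
almost satisfies the boundary inequality. The vectors `b`, `c` are the coordinates along `w` and
along the reflection direction `Γ`; in the interior `c = 0` and `Γ = 0`. -/
theorem IsSubsolution.exists_le_along {Ω : Set (Space n)}
    (hbdd : Bornology.IsBounded Ω) {H : Space n → Space n → ℝ} {γ : Space n → Space n}
    {g φ : Space n → ℝ} (hH : ContinuousOn (fun q : Space n × Space n => H q.1 q.2)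
      (closure Ω ×ˢ univ)) (hγ : ContinuousOn γ (frontier Ω)) (hg : ContinuousOn g (frontier Ω))
    {K : ℝ≥0} (hφ : LipschitzOnWith K φ (closure Ω)) (hsub : IsSubsolution Ω H γ g 0 φ)
    {z b c w Γ : Space n} {d : ℝ} (hz : z ∈ closure Ω)
    (hbw : ⟪b, w⟫_ℝ • w = w) (hbw0 : 0 ≤ ⟪b, w⟫_ℝ) (hbw1 : ⟪b, w⟫_ℝ ≤ 1) (hd : d * ⟪b, w⟫_ℝ = d)
    (hbΓ : ⟪b, Γ⟫_ℝ = 0)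
    (hcw : ⟪c, w⟫_ℝ = 0) (hcΓ : ⟪c, Γ⟫_ℝ • Γ = Γ) (hcΓ0 : 0 ≤ ⟪c, Γ⟫_ℝ) (hcΓ1 : ⟪c, Γ⟫_ℝ ≤ 1)
    (hcurve : ∀ e > 0, ∀ᶠ s in 𝓝 (0 : ℝ), ∃ x ∈ closure Ω, ‖x - z - s • w‖ ≤ e * |s| ∧
      φ x ≤ φ z + d * s + e * |s|)
    (hcin : ∀ e > 0, ∀ᶠ y in 𝓝[closure Ω] z, ⟪c, y - z⟫_ℝ ≤ e * ‖y - z‖)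
    (hcfr : ∀ e > 0, ∀ᶠ y in 𝓝[frontier Ω] z, -(e * ‖y - z‖) ≤ ⟪c, y - z⟫_ℝ)
    (hzΓ : z ∈ frontier Ω → Γ = γ z ∧ ⟪c, Γ⟫_ℝ = 1) {e : ℝ} (he : 0 < e) :
    ∃ p, H z p ≤ 0 ∧ ⟪p, w⟫_ℝ ≤ d + e ∧ ⟪p, Γ⟫_ℝ ≤ g z * ⟪c, Γ⟫_ℝ + 2 * e := by
  have hcomp : IsCompact (closure Ω) :=
    Metric.isCompact_of_isClosed_isBounded isClosed_closure hbdd.closure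
  -- Slightly above `g z`, so that the boundary alternative in the viscosity inequality fails
  -- strictly.
  obtain ⟨G, hG⟩ : ∃ x : ℝ, x = g z + e := ⟨_, rfl⟩
  obtain ⟨C₁, hC₁⟩ : ∃ x : ℝ, x = K * ‖Γ‖ + |G| := ⟨_, rfl⟩
  obtain ⟨C₂, hC₂⟩ : ∃ x : ℝ, x = K ^ 2 / 4 + C₁ ^ 2 / 4 + 1 := ⟨_, rfl⟩
  have hC₁0 : 0 ≤ C₁ := by rw [hC₁]; positivity
  have hC₂0 : 0 < C₂ := by rw [hC₂]; positivity
  -- Below, `κ (N s)² ≤ C₂` with `C₂` independent of `κ`. This choice makes the error `2 κ N |s|` in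
  -- the slope along `w` at most `e`.
  obtain ⟨κ, hκ⟩ : ∃ x : ℝ, x = e ^ 2 / (4 * C₂) := ⟨_, rfl⟩
  have hκ0 : 0 < κ := by rw [hκ]; positivity
  have hκC : 4 * κ * C₂ = e ^ 2 := by rw [hκ]; field_simp
  set a : Space n := d • b + G • c with ha
  set P : Space n →L[ℝ] Space n := ContinuousLinearMap.id ℝ (Space n) -
    (innerSL ℝ b).smulRight w - (innerSL ℝ c).smulRight Γ with hP
  have hPu : ∀ u, P u = u - ⟪b, u⟫_ℝ • w - ⟪c, u⟫_ℝ • Γ := fun u => by simp [hP]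
  have hPw : P w = 0 := by rw [hPu, hbw, hcw]; simp
  have hPΓ : P Γ = 0 := by rw [hPu, hcΓ, hbΓ]; simp
  have haw : ⟪a, w⟫_ℝ = d := by
    rw [ha, inner_add_left, real_inner_smul_left, real_inner_smul_left, hcw, hd]; simp
  have haΓ : ⟪a, Γ⟫_ℝ = G * ⟪c, Γ⟫_ℝ := by
    rw [ha, inner_add_left, real_inner_smul_left, real_inner_smul_left, hbΓ]; simp
  let N : ℕ → ℝ := fun k => (k : ℝ) + 1
  have hN0 : ∀ k, 0 < N k := fun k => by positivity
  have hNt : Tendsto N atTop atTop := tendsto_natCast_atTop_atTop.atTop_add tendsto_const_nhds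
  have hmax : ∀ k, ∃ y ∈ closure Ω,
      IsMaxOn (fun y => φ y - quadTest z a b c P (N k) κ y) (closure Ω) y := fun k =>
    hcomp.exists_isMaxOn ⟨z, hz⟩
      (hφ.continuousOn.sub (contDiff_quadTest z a b c P (N k) κ).continuous.continuousOn)
  choose y hy hymax using hmax
  set u : ℕ → Space n := fun k => y k - z with hu
  set p : ℕ → Space n := fun k => quadTestGrad a b c P (N k) κ (u k) with hp
  set Q : ℕ → ℝ := fun k => ‖P (u k)‖ ^ 2 + ⟪c, u k⟫_ℝ ^ 2 + κ * ⟪b, u k⟫_ℝ ^ 2 with hQ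
  have hQ0 : ∀ k, 0 ≤ Q k := fun k => by positivity
  have hQle : ∀ k, N k * Q k ≤ φ (y k) - φ z - ⟪a, u k⟫_ℝ := by
    intro k
    have h : φ z - quadTest z a b c P (N k) κ z ≤ φ (y k) - quadTest z a b c P (N k) κ (y k) :=
      hymax k hz
    have h0 : quadTest z a b c P (N k) κ z = 0 := by simp [quadTest]
    have h1 : quadTest z a b c P (N k) κ (y k) = ⟪a, u k⟫_ℝ + N k * Q k := rfl
    linarith
  have hφle : ∀ k, φ (y k) - φ z ≤ K * ‖u k‖ := fun k => by
    have := hφ.dist_le_mul _ (hy k) _ hz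
    rw [Real.dist_eq, dist_eq_norm] at this
    exact (le_abs_self _).trans this
  have hudec : ∀ k, ‖u k‖ ≤ ‖P (u k)‖ + |⟪b, u k⟫_ℝ| * ‖w‖ + |⟪c, u k⟫_ℝ| * ‖Γ‖ := by
    intro k
    have h : u k = P (u k) + ⟪b, u k⟫_ℝ • w + ⟪c, u k⟫_ℝ • Γ := by rw [hPu]; abel
    have h2 := norm_add₃_le (a := P (u k)) (b := ⟪b, u k⟫_ℝ • w) (c := ⟪c, u k⟫_ℝ • Γ)
    rw [← h] at h2
    simpa [norm_smul] using h2
  -- the maximum points are at distance `O(1 / N)`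
  obtain ⟨C, hC⟩ : ∃ x : ℝ, x = 3 * (1 + ‖w‖ ^ 2 / κ + ‖Γ‖ ^ 2) := ⟨_, rfl⟩
  have hC0 : 0 ≤ C := by rw [hC]; positivity
  have huQ : ∀ k, ‖u k‖ ^ 2 ≤ C * Q k := by
    intro k
    have h1 := pow_le_pow_left₀ (norm_nonneg _) (hudec k) 2
    have h2 := h1.trans sq_add_add_le
    refine h2.trans ?_
    rw [mul_pow, mul_pow, sq_abs, sq_abs]
    have h3 : ⟪b, u k⟫_ℝ ^ 2 * ‖w‖ ^ 2 = ‖w‖ ^ 2 / κ * (κ * ⟪b, u k⟫_ℝ ^ 2) := by field_simp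
    have h4 : κ * ⟪b, u k⟫_ℝ ^ 2 ≤ Q k := by simp only [hQ]; linarith [sq_nonneg ‖P (u k)‖, sq_nonneg ⟪c, u k⟫_ℝ]
    have h5 : ⟪c, u k⟫_ℝ ^ 2 ≤ Q k := by
      simp only [hQ]; linarith [sq_nonneg ‖P (u k)‖, mul_nonneg hκ0.le (sq_nonneg ⟪b, u k⟫_ℝ)]
    have h6 : ‖P (u k)‖ ^ 2 ≤ Q k := by
      simp only [hQ]
      linarith [sq_nonneg ⟪c, u k⟫_ℝ, mul_nonneg hκ0.le (sq_nonneg ⟪b, u k⟫_ℝ)]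
    have h7 := mul_le_mul_of_nonneg_left h4 (show 0 ≤ ‖w‖ ^ 2 / κ by positivity)
    have h8 := mul_le_mul_of_nonneg_right h5 (sq_nonneg ‖Γ‖)
    rw [h3, hC]
    linarith
  obtain ⟨A, hA⟩ : ∃ x : ℝ, x = C * (K + ‖a‖) := ⟨_, rfl⟩
  have hA0 : 0 ≤ A := by rw [hA]; positivity
  have hNu : ∀ k, N k * ‖u k‖ ≤ A := by
    intro k
    rcases (norm_nonneg (u k)).eq_or_lt with h0 | h0
    · rw [← h0]; simpa using hA0
    have h1 : N k * Q k ≤ (K + ‖a‖) * ‖u k‖ := by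
      have := neg_le_of_abs_le (abs_real_inner_le_norm a (u k))
      linarith [hQle k, hφle k]
    have h2 : N k * ‖u k‖ * ‖u k‖ ≤ A * ‖u k‖ := by
      calc N k * ‖u k‖ * ‖u k‖ = N k * ‖u k‖ ^ 2 := by ring
        _ ≤ N k * (C * Q k) := mul_le_mul_of_nonneg_left (huQ k) (hN0 k).le
        _ = C * (N k * Q k) := by ring
        _ ≤ C * ((K + ‖a‖) * ‖u k‖) := mul_le_mul_of_nonneg_left h1 hC0
        _ = A * ‖u k‖ := by rw [hA]; ring
    exact le_of_mul_le_mul_right h2 h0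
  have hu0 : Tendsto u atTop (𝓝 0) := by
    refine squeeze_zero_norm (a := fun k => A / N k) (fun k => ?_) (hNt.const_div_atTop A)
    rw [le_div_iff₀ (hN0 k), mul_comm]; exact hNu k
  have hyz : Tendsto y atTop (𝓝 z) := by
    have := hu0.add_const z
    simpa [hu] using this
  have hyzc : Tendsto y atTop (𝓝[closure Ω] z) :=
    tendsto_nhdsWithin_iff.2 ⟨hyz, .of_forall hy⟩
  obtain ⟨B, hB⟩ : ∃ x : ℝ, x = ‖a‖ + 2 * (‖P‖ ^ 2 + ‖c‖ ^ 2 + κ * ‖b‖ ^ 2) * A := ⟨_, rfl⟩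
  have hpB : ∀ k, ‖p k‖ ≤ B := fun k =>
    (norm_quadTestGrad_le a b c P (N k) κ (hN0 k).le hκ0.le (u k)).trans
      (hB ▸ add_le_add_right (mul_le_mul_of_nonneg_left (hNu k) (by positivity)) _)
  have hB0 : 0 ≤ B := (norm_nonneg _).trans (hpB 0)
  have hgrad : ∀ k, gradient (quadTest z a b c P (N k) κ) (y k) = p k := fun k =>
    gradient_quadTest z a b c P (N k) κ (y k)
  have hpw : ∀ k, ⟪p k, w⟫_ℝ = d + 2 * N k * (κ * ⟪b, u k⟫_ℝ * ⟪b, w⟫_ℝ) := fun k => by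
    rw [hp, inner_quadTestGrad, haw, hPw, hcw]; simp
  have hpΓ : ∀ k, ⟪p k, Γ⟫_ℝ = (G + 2 * N k * ⟪c, u k⟫_ℝ) * ⟪c, Γ⟫_ℝ := fun k => by
    rw [hp, inner_quadTestGrad, haΓ, hPΓ, hbΓ]; simp; ring
  -- the viscosity inequality at the maximum points
  obtain ⟨e', he'⟩ : ∃ x : ℝ, x = e / (8 * (A + 1)) := ⟨_, rfl⟩
  have he'0 : 0 < e' := by rw [he']; positivity
  have he'A : e' * A ≤ e / 8 := by
    rw [he', div_mul_eq_mul_div, div_le_div_iff₀ (by positivity) (by positivity)]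
    linarith
  have hNe' : ∀ k, N k * (e' * ‖u k‖) ≤ e / 8 := fun k => by
    calc N k * (e' * ‖u k‖) = e' * (N k * ‖u k‖) := by ring
      _ ≤ e' * A := mul_le_mul_of_nonneg_left (hNu k) he'0.le
      _ ≤ _ := he'A
  have hpH : ∀ᶠ k in atTop, H (y k) (p k) ≤ 0 := by
    have hfr : ∀ᶠ y' in 𝓝[frontier Ω] z, z ∈ frontier Ω ∧ -(e' * ‖y' - z‖) ≤ ⟪c, y' - z⟫_ℝ ∧
        ‖γ y' - γ z‖ * B ≤ e / 4 ∧ g y' ≤ g z + e / 4 := by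
      by_cases hzf : z ∈ frontier Ω
      · have h1 : Tendsto (fun y' => ‖γ y' - γ z‖ * B) (𝓝[frontier Ω] z) (𝓝 0) := by
          have := (((hγ z hzf).tendsto.sub_const (γ z)).norm).mul_const B
          simpa using this
        filter_upwards [hcfr e' he'0, h1.eventually (ge_mem_nhds (show 0 < e / 4 by positivity)),
          (hg z hzf).eventually (ge_mem_nhds (show g z < g z + e / 4 by linarith))]
          with y' h2 h3 h4 using ⟨hzf, h2, h3, h4⟩
      · have : 𝓝[frontier Ω] z = ⊥ := by
          rw [← notMem_closure_iff_nhdsWithin_eq_bot, isClosed_frontier.closure_eq]; exact hzf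
        rw [this]; exact eventually_bot
    rw [eventually_nhdsWithin_iff] at hfr
    filter_upwards [hyz.eventually hfr] with k hk
    rcases (closure_eq_self_union_frontier Ω ▸ hy k : y k ∈ Ω ∪ frontier Ω) with hi | hf
    · have := hsub.interior_test _ hi _ (contDiff_quadTest z a b c P (N k) κ) (hymax k)
      rwa [hgrad] at this
    · have := hsub.boundary_test _ hf _ (contDiff_quadTest z a b c P (N k) κ) (hymax k)
      rw [hgrad] at this
      -- The slope along `Γ` is at least `g z + 3e/4`. Moving `γ` from `z` to `y k` costs `e/4`, and
      -- `g (y k) ≤ g z + e/4`, so the boundary alternative is impossible.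
      refine this.resolve_right fun hle => ?_
      obtain ⟨hzf, h1, h2, h3⟩ := hk hf
      obtain ⟨hΓ, hcΓ'⟩ := hzΓ hzf
      have h4 := hpΓ k
      rw [hcΓ', mul_one] at h4
      have h5 : |⟪γ (y k) - γ z, p k⟫_ℝ| ≤ e / 4 :=
        (abs_real_inner_le_norm _ _).trans
          ((mul_le_mul_of_nonneg_left (hpB k) (norm_nonneg _)).trans h2)
      rw [inner_sub_left, ← hΓ, real_inner_comm, real_inner_comm (p k) Γ, h4] at h5
      have h6 := mul_le_mul_of_nonneg_left h1 (hN0 k).le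
      have h7 := hNe' k
      rw [real_inner_comm] at hle
      have h8 := (abs_le.1 h5).1
      change N k * -(e' * ‖u k‖) ≤ N k * ⟪c, u k⟫_ℝ at h6
      linarith
  have hpΓle : ∀ᶠ k in atTop, ⟪p k, Γ⟫_ℝ ≤ g z * ⟪c, Γ⟫_ℝ + 2 * e := by
    filter_upwards [hyzc.eventually (hcin e' he'0)] with k hk
    have h6 := mul_le_mul_of_nonneg_left hk (hN0 k).le
    have h7 := hNe' k
    change N k * ⟪c, u k⟫_ℝ ≤ N k * (e' * ‖u k‖) at h6
    rw [hpΓ, hG]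
    have h8 : (g z + e + 2 * N k * ⟪c, u k⟫_ℝ) * ⟪c, Γ⟫_ℝ ≤ (g z + 2 * e) * ⟪c, Γ⟫_ℝ :=
      mul_le_mul_of_nonneg_right (by linarith) hcΓ0
    linarith [mul_le_mul_of_nonneg_left hcΓ1 he.le]
  have hpwle : ∀ᶠ k in atTop, ⟪p k, w⟫_ℝ ≤ d + e := by
    obtain ⟨ε, hε⟩ : ∃ x : ℝ, x = 1 / ((K + 1) * (‖b‖ * A + 1)) := ⟨_, rfl⟩
    have hε0 : 0 < ε := by rw [hε]; positivity
    have hsb : Tendsto (fun k => ⟪b, u k⟫_ℝ) atTop (𝓝 0) := by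
      have := (tendsto_const_nhds (x := b)).inner (𝕜 := ℝ) hu0
      simpa using this
    filter_upwards [hsb.eventually (hcurve ε hε0)] with k hk
    obtain ⟨x, hx, hx1, hx2⟩ := hk
    -- Compare `y k` with the curve point `x` at parameter `s`: the linear term `d * s` cancels, and
    -- only the components transverse to `w` contribute, up to `ε * |s|`.
    set s : ℝ := ⟪b, u k⟫_ℝ with hs
    set β : ℝ := ⟪c, u k⟫_ℝ with hβ
    have h1 : φ (y k) - φ x ≤ K * (‖P (u k)‖ + |β| * ‖Γ‖ + ε * |s|) := by
      have h2 := hφ.dist_le_mul _ (hy k) _ hx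
      rw [Real.dist_eq, dist_eq_norm] at h2
      refine ((le_abs_self _).trans h2).trans (mul_le_mul_of_nonneg_left ?_ K.2)
      have h3 : y k - x = P (u k) + β • Γ - (x - z - s • w) := by
        rw [hPu, ← hs, ← hβ, show u k = y k - z from rfl]; abel
      rw [h3]
      refine (norm_sub_le _ _).trans (add_le_add ((norm_add_le _ _).trans_eq ?_) hx1)
      rw [norm_smul, Real.norm_eq_abs]
    have hau : ⟪a, u k⟫_ℝ = d * s + G * β := by
      rw [ha, inner_add_left, real_inner_smul_left, real_inner_smul_left]
    have hmain : N k * Q k ≤ K * ‖P (u k)‖ + C₁ * |β| + (K + 1) * (ε * |s|) := by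
      have h4 : -(G * β) ≤ |G| * |β| := by rw [← abs_mul]; exact neg_le_abs _
      rw [hC₁]
      linarith [hQle k]
    have hsA : N k * |s| ≤ ‖b‖ * A := by
      calc N k * |s| ≤ N k * (‖b‖ * ‖u k‖) :=
            mul_le_mul_of_nonneg_left (abs_real_inner_le_norm _ _) (hN0 k).le
        _ = ‖b‖ * (N k * ‖u k‖) := by ring
        _ ≤ _ := mul_le_mul_of_nonneg_left (hNu k) (norm_nonneg _)
    have hεs : (K + 1) * (ε * (N k * |s|)) ≤ 1 := by
      calc (K + 1) * (ε * (N k * |s|)) ≤ (K + 1) * (ε * (‖b‖ * A + 1)) := by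
            gcongr; linarith
        _ = 1 := by rw [hε]; field_simp
    have hmul := mul_le_mul_of_nonneg_left hmain (hN0 k).le
    -- After multiplication by `N k`, completing squares in `N k * ‖P (u k)‖` and `N k * |β|`
    -- absorbs the transverse terms.
    have hS : κ * (N k * s) ^ 2 ≤ C₂ := by
      have e1 : N k * (N k * Q k) = (N k * ‖P (u k)‖) ^ 2 + (N k * |β|) ^ 2 + κ * (N k * s) ^ 2 := by
        simp only [hQ]; rw [mul_pow (N k) |β|, sq_abs]; ring
      rw [e1] at hmul
      rw [hC₂]
      linarith [sq_nonneg (N k * ‖P (u k)‖ - K / 2), sq_nonneg (N k * |β| - C₁ / 2)]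
    have habs : |2 * κ * (N k * s)| ≤ e := by
      refine abs_le_of_sq_le_sq ?_ he.le
      calc (2 * κ * (N k * s)) ^ 2 = 4 * κ * (κ * (N k * s) ^ 2) := by ring
        _ ≤ 4 * κ * C₂ := mul_le_mul_of_nonneg_left hS (by positivity)
        _ = e ^ 2 := hκC
    rw [hpw]
    have h9 : 2 * N k * (κ * s * ⟪b, w⟫_ℝ) = (2 * κ * (N k * s)) * ⟪b, w⟫_ℝ := by ring
    have h10 := mul_le_mul_of_nonneg_right ((le_abs_self _).trans habs) hbw0
    rw [h9]
    linarith [mul_le_mul_of_nonneg_left hbw1 he.le]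
  -- pass to the limit
  have hU : (hyperfilter ℕ : Filter ℕ) ≤ atTop := by
    rw [← Nat.cofinite_eq_atTop]; exact hyperfilter_le_cofinite
  obtain ⟨q, -, hq⟩ := (isCompact_closedBall (0 : Space n) B).ultrafilter_le_nhds'
    ((hyperfilter ℕ).map p)
    (Eventually.of_forall fun k => mem_closedBall_zero_iff.2 (hpB k) :
      ∀ᶠ k in (hyperfilter ℕ : Filter ℕ), p k ∈ Metric.closedBall 0 B)
  have hq' : Tendsto p (hyperfilter ℕ) (𝓝 q) := hq
  refine ⟨q, ?_, ?_, ?_⟩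
  · have h1 : Tendsto (fun k => (y k, p k)) (hyperfilter ℕ) (𝓝[closure Ω ×ˢ univ] (z, q)) :=
      tendsto_nhdsWithin_iff.2 ⟨(hyz.mono_left hU).prodMk_nhds hq',
        .of_forall fun k => ⟨hy k, mem_univ _⟩⟩
    exact le_of_tendsto ((hH (z, q) ⟨hz, mem_univ _⟩).tendsto.comp h1) (hpH.filter_mono hU)
  · exact le_of_tendsto (hq'.inner tendsto_const_nhds) (hpwle.filter_mono hU)
  · exact le_of_tendsto (hq'.inner tendsto_const_nhds) (hpΓle.filter_mono hU)

/-! ### Rate of decrease of a subsolution along reflected curves -/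

section Curve

variable {Ω : Set (Space n)} {H : Space n → Space n → ℝ} {γ : Space n → Space n}
  {g φ : Space n → ℝ} {K : ℝ≥0}

/-- Increments of `φ` are dominated by those of `X`, which are `o(s - t)`. This settles zero
velocity, where no coordinate dual to `w` exists. -/
theorem deriv_comp_eq_zero_of_lipschitzOnWith (hφ : LipschitzOnWith K φ (closure Ω))
    {X : ℝ → Space n} {t d : ℝ} (hX : ∀ᶠ s in 𝓝 t, X s ∈ closure Ω)
    (hw : HasDerivAt X 0 t) (hd : HasDerivAt (fun s => φ (X s)) d t) : d = 0 := by
  have h1 : (fun s => φ (X s) - φ (X t)) =O[𝓝 t] fun s => X s - X t := by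
    refine Asymptotics.IsBigO.of_bound K ?_
    filter_upwards [hX] with s hs
    have := hφ.dist_le_mul _ hs _ hX.self_of_nhds
    rwa [Real.dist_eq, dist_eq_norm] at this
  have h2 : (fun s => X s - X t) =o[𝓝 t] fun s => s - t := by
    have := hasDerivAt_iff_isLittleO.1 hw
    simpa using this
  have h3 : HasDerivAt (fun s => φ (X s)) 0 t :=
    hasDerivAt_iff_isLittleO.2 (by simpa using h1.trans_isLittleO h2)
  exact hd.unique h3

/-- A subsolution decreases along a reflected curve at most at the rate of the running cost. -/
theorem IsSubsolution.neg_deriv_le (hΩ : IsOpen Ω) (hbdd : Bornology.IsBounded Ω)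
    (hC1 : HasC1Boundary Ω)
    (hH : ContinuousOn (fun q : Space n × Space n => H q.1 q.2) (closure Ω ×ˢ univ))
    (hγ : ContinuousOn γ (frontier Ω)) (hg : ContinuousOn g (frontier Ω)) (hobl : IsOblique Ω γ)
    (hφ : LipschitzOnWith K φ (closure Ω)) (hsub : IsSubsolution Ω H γ g 0 φ)
    {X : ℝ → Space n} {t d l r : ℝ} {v : Space n} (hX : ∀ᶠ s in 𝓝 t, X s ∈ closure Ω)
    (hw : HasDerivAt X (v - l • γ (X t)) t) (hd : HasDerivAt (fun s => φ (X s)) d t)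
    (hl : 0 ≤ l) (hlΩ : X t ∈ Ω → l = 0) (hr : ∀ q, ⟪-v, q⟫_ℝ - H (X t) q ≤ r) :
    -d ≤ r + g (X t) * l := by
  obtain ⟨w, hwdef⟩ : ∃ w, w = v - l • γ (X t) := ⟨_, rfl⟩
  obtain ⟨z, hzdef⟩ : ∃ z, z = X t := ⟨_, rfl⟩
  have hz : z ∈ closure Ω := hzdef ▸ hX.self_of_nhds
  rw [← hwdef] at hw
  have hcurve : ∀ e > 0, ∀ᶠ s in 𝓝 (0 : ℝ), ∃ x ∈ closure Ω, ‖x - z - s • w‖ ≤ e * |s| ∧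
      φ x ≤ φ z + d * s + e * |s| := by
    intro e he
    have h1 := (hasDerivAt_iff_isLittleO_nhds_zero.1 hw).bound he
    have h2 := (hasDerivAt_iff_isLittleO_nhds_zero.1 hd).bound he
    have h3 : Tendsto (fun s => t + s) (𝓝 0) (𝓝 t) := by
      have := (continuous_const_add t).tendsto (0 : ℝ)
      rwa [add_zero] at this
    filter_upwards [h1, h2, h3.eventually hX] with s hs1 hs2 hs3
    refine ⟨X (t + s), hs3, ?_, ?_⟩
    · rw [hzdef]; exact hs1
    · rw [Real.norm_eq_abs, Real.norm_eq_abs, smul_eq_mul] at hs2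
      rw [hzdef]
      linarith [(abs_le.1 hs2).2]
  -- it suffices to find approximate subgradients
  suffices h : ∀ e > 0, ∃ p, H z p ≤ 0 ∧ ⟪p, w⟫_ℝ ≤ d + e ∧ l * ⟪p, γ z⟫_ℝ ≤ l * (g z + 2 * e) by
    refine le_of_forall_pos_le_add fun δ hδ => ?_
    have hpos : 0 < 1 + 2 * l := by positivity
    obtain ⟨p, hp1, hp2, hp3⟩ := h (δ / (1 + 2 * l)) (by positivity)
    have h1 := hr p
    rw [inner_neg_left, real_inner_comm] at h1
    rw [hwdef, inner_sub_right, real_inner_smul_right, ← hzdef] at hp2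
    rw [← hzdef] at h1 ⊢
    have h2 : δ / (1 + 2 * l) * (1 + 2 * l) = δ := div_mul_cancel₀ _ hpos.ne'
    linarith
  intro e he
  have key : ∀ c Γ : Space n, ⟪c, w⟫_ℝ = 0 → ⟪c, Γ⟫_ℝ • Γ = Γ → 0 ≤ ⟪c, Γ⟫_ℝ → ⟪c, Γ⟫_ℝ ≤ 1 →
      (∀ e > 0, ∀ᶠ y in 𝓝[closure Ω] z, ⟪c, y - z⟫_ℝ ≤ e * ‖y - z‖) →
      (∀ e > 0, ∀ᶠ y in 𝓝[frontier Ω] z, -(e * ‖y - z‖) ≤ ⟪c, y - z⟫_ℝ) →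
      (z ∈ frontier Ω → Γ = γ z ∧ ⟪c, Γ⟫_ℝ = 1) →
      ∃ p, H z p ≤ 0 ∧ ⟪p, w⟫_ℝ ≤ d + e ∧ ⟪p, Γ⟫_ℝ ≤ g z * ⟪c, Γ⟫_ℝ + 2 * e := by
    intro c Γ hcw hcΓ hcΓ0 hcΓ1 hcin hcfr hzΓ
    -- This vector is the coordinate along `w` that vanishes on `Γ`. For `w = 0` the inverse is `0`,
    -- and so is the vector.
    have hbw : ⟪(‖w‖ ^ 2)⁻¹ • (w - ⟪w, Γ⟫_ℝ • c), w⟫_ℝ = (‖w‖ ^ 2)⁻¹ * ‖w‖ ^ 2 := by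
      rw [real_inner_smul_left, inner_sub_left, real_inner_smul_left, hcw,
        real_inner_self_eq_norm_sq]; ring
    have hbΓ : ⟪(‖w‖ ^ 2)⁻¹ • (w - ⟪w, Γ⟫_ℝ • c), Γ⟫_ℝ = 0 := by
      have h1 : ⟪w, Γ⟫_ℝ * ⟪c, Γ⟫_ℝ = ⟪w, Γ⟫_ℝ := by
        rw [mul_comm, ← real_inner_smul_right, hcΓ]
      rw [real_inner_smul_left, inner_sub_left, real_inner_smul_left, h1]; ring
    rcases eq_or_ne w 0 with h0 | h0
    · have hd0 : d = 0 := deriv_comp_eq_zero_of_lipschitzOnWith hφ hX (h0 ▸ hw) hd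
      refine hsub.exists_le_along hbdd hH hγ hg hφ hz ?_ ?_ ?_ ?_ hbΓ hcw hcΓ hcΓ0 hcΓ1 hcurve
        hcin hcfr hzΓ he <;> simp [h0, hd0]
    · have h1 : (‖w‖ ^ 2)⁻¹ * ‖w‖ ^ 2 = 1 :=
        inv_mul_cancel₀ (pow_ne_zero 2 (norm_ne_zero_iff.2 h0))
      rw [h1] at hbw
      refine hsub.exists_le_along hbdd hH hγ hg hφ hz ?_ ?_ ?_ ?_ hbΓ hcw hcΓ hcΓ0 hcΓ1 hcurve
        hcin hcfr hzΓ he <;> simp [hbw]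
  rcases (closure_eq_self_union_frontier Ω ▸ hz : z ∈ Ω ∪ frontier Ω) with hi | hf
  · have hzf : z ∉ frontier Ω := fun h => (hΩ.frontier_eq ▸ h : z ∈ closure Ω \ Ω).2 hi
    obtain ⟨p, h1, h2, -⟩ := key 0 0 (by simp) (by simp) (by simp) (by simp)
      (fun e he => .of_forall fun y => by simp only [inner_zero_left]; positivity)
      (fun e he => .of_forall fun y => by
        simp only [inner_zero_left]; exact neg_nonpos.2 (by positivity))
      (fun h => absurd h hzf)
    refine ⟨p, h1, h2, ?_⟩
    rw [hlΩ (hzdef ▸ hi)]; simp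
  · obtain ⟨ψ, hψ⟩ := hC1 z hf
    obtain ⟨ν, hν⟩ : ∃ ν, IsOuterUnitNormal Ω z ν := ⟨_, ψ, hψ, rfl⟩
    have hpos := hobl z hf ν hν
    have hνw : ⟪ν, w⟫_ℝ = 0 := by rw [hzdef] at hν; exact hν.inner_deriv_eq_zero hX hw
    have hcΓ : ⟪(⟪ν, γ z⟫_ℝ)⁻¹ • ν, γ z⟫_ℝ = 1 := by
      rw [real_inner_smul_left, inv_mul_cancel₀ hpos.ne']
    obtain ⟨p, h1, h2, h3⟩ := key ((⟪ν, γ z⟫_ℝ)⁻¹ • ν) (γ z)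
      (by rw [real_inner_smul_left, hνw, mul_zero]) (by rw [hcΓ, one_smul])
      (by rw [hcΓ]; exact zero_le_one) hcΓ.le
      (fun e he => by
        filter_upwards [hν.eventually_inner_le (mul_pos he hpos)] with y hy
        rw [real_inner_smul_left, inv_mul_le_iff₀ hpos]
        linarith)
      (fun e he => by
        filter_upwards [hν.eventually_le_inner hΩ (mul_pos he hpos)] with y hy
        rw [real_inner_smul_left, le_inv_mul_iff₀ hpos]
        linarith)
      (fun _ => ⟨rfl, hcΓ⟩)
    rw [hcΓ, mul_one] at h3
    exact ⟨p, h1, h2, mul_le_mul_of_nonneg_left h3 hl⟩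

end Curve

/-! ### Subgradients of convex functions -/

section Subgradient

variable {V : Type*} [NormedAddCommGroup V] [InnerProductSpace ℝ V]

/-- Hahn–Banach separates `(p, f p)` from the strict epigraph, open by continuity. The vertical
coefficient `β` of the functional is negative, and dividing by `-β` leaves the subgradient. -/
theorem exists_subgradient [CompleteSpace V] {f : V → ℝ} (hf : ConvexOn ℝ univ f) (hc : Continuous f) (p : V) :
    ∃ ξ : V, ∀ q, f p + ⟪ξ, q - p⟫_ℝ ≤ f q := by
  have hconv : Convex ℝ {q : V × ℝ | q.1 ∈ univ ∧ f q.1 < q.2} := hf.convex_strict_epigraph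
  have hopen : IsOpen {q : V × ℝ | q.1 ∈ univ ∧ f q.1 < q.2} := by
    simpa using isOpen_lt (hc.comp continuous_fst) continuous_snd
  obtain ⟨F, hF⟩ := geometric_hahn_banach_open_point hconv hopen
    (x := (p, f p)) (by simp)
  obtain ⟨β, hβ⟩ : ∃ β, β = F (0, 1) := ⟨_, rfl⟩
  have hdec : ∀ (q : V) (r : ℝ), F (q, r) = F (q, 0) + r * β := by
    intro q r
    rw [hβ, ← smul_eq_mul, ← map_smul, ← map_add]
    simp
  have hlt : ∀ (q : V) (r : ℝ), f q < r → F (q, 0) + r * β < F (p, 0) + f p * β := by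
    intro q r h
    rw [← hdec, ← hdec]
    exact hF _ ⟨mem_univ _, h⟩
  have hβ0 : β < 0 := by
    have := hlt p (f p + 1) (by linarith)
    linarith
  have hle : ∀ q, F (q, 0) + f q * β ≤ F (p, 0) + f p * β := by
    intro q
    have h : Tendsto (fun r => F (q, 0) + r * β) (𝓝[>] (f q)) (𝓝 (F (q, 0) + f q * β)) :=
      (Continuous.tendsto (by fun_prop) _).mono_left nhdsWithin_le_nhds
    refine le_of_tendsto h ?_
    filter_upwards [self_mem_nhdsWithin] with r hr using (hlt q r hr).le
  obtain ⟨ξ, hξ⟩ := (InnerProductSpace.toDual ℝ V).surjective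
    ((-β⁻¹) • (F.comp (ContinuousLinearMap.inl ℝ V ℝ)))
  refine ⟨ξ, fun q => ?_⟩
  have h1 : ⟪ξ, q - p⟫_ℝ = -β⁻¹ * (F (q, 0) - F (p, 0)) := by
    rw [← InnerProductSpace.toDual_apply_apply, hξ, ← map_sub]
    simp
  have h3 : (-β⁻¹) * (F (q, 0) + f q * β) ≤ (-β⁻¹) * (F (p, 0) + f p * β) :=
    mul_le_mul_of_nonneg_left (hle q) (neg_nonneg.2 (inv_nonpos.2 hβ0.le))
  have h4 : β⁻¹ * β = 1 := inv_mul_cancel₀ hβ0.ne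
  rw [h1]
  have h5 : ∀ u : ℝ, (-β⁻¹) * (u * β) = -u := fun u => by
    rw [show (-β⁻¹) * (u * β) = -(u * (β⁻¹ * β)) by ring, h4, mul_one]
  rw [mul_add, mul_add, h5, h5] at h3
  linarith

/-- Test the subgradient inequality one unit away from `p` in the direction of `ξ`. -/
theorem norm_le_of_subgradient {f : V → ℝ} {p ξ : V} {R B : ℝ}
    (hξ : ∀ q, f p + ⟪ξ, q - p⟫_ℝ ≤ f q) (hp : ‖p‖ ≤ R) (hB : ∀ q, ‖q‖ ≤ R + 1 → |f q| ≤ B) :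
    ‖ξ‖ ≤ 2 * B := by
  have h0 := hB p (by linarith)
  rcases eq_or_ne ξ 0 with h | h
  · rw [h, norm_zero]; linarith [abs_nonneg (f p)]
  have hn : 0 < ‖ξ‖ := norm_pos_iff.2 h
  have h1 := hξ (p + (‖ξ‖)⁻¹ • ξ)
  rw [add_sub_cancel_left, real_inner_smul_right, real_inner_self_eq_norm_sq, sq, ← mul_assoc,
    inv_mul_cancel₀ hn.ne', one_mul] at h1
  have h2 := hB (p + (‖ξ‖)⁻¹ • ξ) (by
    refine (norm_add_le _ _).trans ?_
    rw [norm_smul, norm_inv, norm_norm, inv_mul_cancel₀ hn.ne']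
    linarith)
  linarith [(abs_le.1 h0).1, (abs_le.1 h2).2]

end Subgradient

/-! ### The augmented state and its admissible velocities -/

/-- States `(η, ∫ v, ∫ l, cost)` of the reflected dynamics. -/
abbrev State (n : ℕ) : Type := Space n × Space n × ℝ × ℝ

/-- Admissible velocities `(v - l γ, v, l, ζ)` of the state at the position `x`, where
`ζ ≥ L(x, -v) + g l`. -/
def velocitySet (Ω : Set (Space n)) (H : Space n → Space n → ℝ) (γ : Space n → Space n)
    (g : Space n → ℝ) (C M : ℝ) (x : Space n) : Set (State n) :=
  {w | w.1 = w.2.1 - w.2.2.1 • γ x ∧ ‖w.2.1‖ ≤ C ∧ 0 ≤ w.2.2.1 ∧ w.2.2.1 ≤ M ∧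
    |w.2.2.2 - g x * w.2.2.1| ≤ C ∧ (∀ q, ⟪-w.2.1, q⟫_ℝ - H x q + g x * w.2.2.1 ≤ w.2.2.2) ∧
    (x ∈ Ω → w.2.2.1 = 0)}

section VelocitySet

variable {Ω : Set (Space n)} {H : Space n → Space n → ℝ} {γ : Space n → Space n}
  {g : Space n → ℝ} {C M : ℝ}

theorem convex_velocitySet (x : Space n) : Convex ℝ (velocitySet Ω H γ g C M x) := by
  rintro ⟨ξ, v, l, ζ⟩ ⟨h1, h2, h3, h4, h5, h6, h7⟩ ⟨ξ', v', l', ζ'⟩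
    ⟨h1', h2', h3', h4', h5', h6', h7'⟩ a b ha hb hab
  dsimp only at h1 h2 h3 h4 h5 h6 h7 h1' h2' h3' h4' h5' h6' h7'
  have hsum : ∀ r : ℝ, r = a * r + b * r := fun r => by rw [← add_mul, hab, one_mul]
  refine ⟨?_, ?_, ?_, ?_, ?_, fun q => ?_, fun hx => ?_⟩
  · simp only [Prod.smul_mk, Prod.mk_add_mk, smul_eq_mul, h1, h1']
    module
  · simp only [Prod.smul_mk, Prod.mk_add_mk]
    have := convex_closedBall (0 : Space n) C (mem_closedBall_zero_iff.2 h2)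
      (mem_closedBall_zero_iff.2 h2') ha hb hab
    exact mem_closedBall_zero_iff.1 this
  · simp only [Prod.smul_mk, Prod.mk_add_mk, smul_eq_mul]
    positivity
  · simp only [Prod.smul_mk, Prod.mk_add_mk, smul_eq_mul]
    rw [hsum M]
    gcongr
  · simp only [Prod.smul_mk, Prod.mk_add_mk, smul_eq_mul]
    have e1 : a * ζ + b * ζ' - g x * (a * l + b * l') =
        a * (ζ - g x * l) + b * (ζ' - g x * l') := by ring
    rw [e1, hsum C]
    refine (abs_add_le _ _).trans ?_
    rw [abs_mul, abs_mul, abs_of_nonneg ha, abs_of_nonneg hb]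
    gcongr
  · simp only [Prod.smul_mk, Prod.mk_add_mk, smul_eq_mul]
    have e1 := mul_le_mul_of_nonneg_left (h6 q) ha
    have e2 := mul_le_mul_of_nonneg_left (h6' q) hb
    have e3 := hsum (H x q)
    simp only [inner_neg_left, inner_add_left, real_inner_smul_left] at e1 e2 ⊢
    linarith
  · simp only [Prod.smul_mk, Prod.mk_add_mk, smul_eq_mul, h7 hx, h7' hx, mul_zero, add_zero]

/-- Switching reflection off inside is a closed condition because `Ω` is open. The inequality with
`H` is paired with membership in the closure, outside which `H` need not be continuous. -/
theorem isClosed_graph_velocitySet (hΩ : IsOpen Ω)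
    (hH : ContinuousOn (fun q : Space n × Space n => H q.1 q.2) (closure Ω ×ˢ univ))
    (hγ : Continuous γ) (hg : Continuous g) :
    IsClosed {q : Space n × State n | q.1 ∈ closure Ω ∧ q.2 ∈ velocitySet Ω H γ g C M q.1} := by
  have hcl : IsClosed {q : Space n × State n | q.1 ∈ closure Ω} :=
    isClosed_closure.preimage continuous_fst
  have hHc : ∀ q : Space n, IsClosed {y : Space n × State n | y.1 ∈ closure Ω ∧
      ⟪-y.2.2.1, q⟫_ℝ - H y.1 q + g y.1 * y.2.2.2.1 ≤ y.2.2.2.2} := by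
    intro q
    refine hcl.isClosed_le ?_ (Continuous.continuousOn (by fun_prop))
    have h1 : ContinuousOn (fun y : Space n × State n => H y.1 q) {y | y.1 ∈ closure Ω} :=
      hH.comp (f := fun y : Space n × State n => (y.1, q))
        (Continuous.continuousOn (by fun_prop)) fun y hy => ⟨hy, mem_univ _⟩
    exact ((Continuous.continuousOn (by fun_prop)).sub h1).add
      (Continuous.continuousOn (by fun_prop))
  have hset : {q : Space n × State n | q.1 ∈ closure Ω ∧ q.2 ∈ velocitySet Ω H γ g C M q.1} =
      {y | y.1 ∈ closure Ω} ∩ {y | y.2.1 = y.2.2.1 - y.2.2.2.1 • γ y.1} ∩ {y | ‖y.2.2.1‖ ≤ C} ∩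
      {y | 0 ≤ y.2.2.2.1} ∩ {y | y.2.2.2.1 ≤ M} ∩ {y | |y.2.2.2.2 - g y.1 * y.2.2.2.1| ≤ C} ∩
      (⋂ q : Space n, {y : Space n × State n | y.1 ∈ closure Ω ∧
      ⟪-y.2.2.1, q⟫_ℝ - H y.1 q + g y.1 * y.2.2.2.1 ≤ y.2.2.2.2}) ∩
      ({y | y.1 ∈ Ωᶜ} ∪ {y | y.2.2.2.1 = 0}) := by
    ext y
    simp only [velocitySet, mem_ofPred_eq, mem_inter_iff, mem_iInter, mem_union, mem_compl_iff,
      imp_iff_not_or]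
    constructor
    · rintro ⟨h0, h1, h2, h3, h4, h5, h6, h7⟩
      exact ⟨⟨⟨⟨⟨⟨⟨h0, h1⟩, h2⟩, h3⟩, h4⟩, h5⟩, fun q => ⟨h0, h6 q⟩⟩, h7⟩
    · rintro ⟨⟨⟨⟨⟨⟨⟨h0, h1⟩, h2⟩, h3⟩, h4⟩, h5⟩, h6⟩, h7⟩
      exact ⟨h0, h1, h2, h3, h4, h5, fun q => (h6 q).2, h7⟩
  rw [hset]
  refine ((((((hcl.inter (isClosed_eq ?_ ?_)).inter (isClosed_le ?_ ?_)).inter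
    (isClosed_le ?_ ?_)).inter (isClosed_le ?_ ?_)).inter (isClosed_le ?_ ?_)).inter
    (isClosed_iInter hHc)).inter ((hΩ.isClosed_compl.preimage continuous_fst).union
    (isClosed_eq ?_ ?_))
  all_goals fun_prop

theorem isClosed_velocitySet (hΩ : IsOpen Ω)
    (hH : ContinuousOn (fun q : Space n × Space n => H q.1 q.2) (closure Ω ×ˢ univ))
    (hγ : Continuous γ) (hg : Continuous g) {x : Space n} (hx : x ∈ closure Ω) :
    IsClosed (velocitySet Ω H γ g C M x) := by
  have h := (isClosed_graph_velocitySet (C := C) (M := M) hΩ hH hγ hg).preimage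
    (f := fun w : State n => (x, w)) (by fun_prop)
  simpa [hx] using h

theorem exists_norm_le_of_mem_velocitySet (hbdd : Bornology.IsBounded Ω)
    (hγ : Continuous γ) (hg : Continuous g) :
    ∃ R : ℝ≥0, ∀ x ∈ closure Ω, ∀ w ∈ velocitySet Ω H γ g C M x, ‖w‖ ≤ R := by
  have hcomp : IsCompact (closure Ω) :=
    Metric.isCompact_of_isClosed_isBounded isClosed_closure hbdd.closure
  obtain ⟨A, hA⟩ := hcomp.exists_bound_of_continuousOn hγ.continuousOn
  obtain ⟨B, hB⟩ := hcomp.exists_bound_of_continuousOn hg.continuousOn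
  refine ⟨(|C| + |M| * |A| + |M| + (|C| + |B| * |M|)).toNNReal, ?_⟩
  rintro x hx ⟨ξ, v, l, ζ⟩ ⟨h1, h2, h3, h4, h5, -, -⟩
  dsimp only at h1 h2 h3 h4 h5
  rw [Real.coe_toNNReal _ (by positivity)]
  have hv : ‖v‖ ≤ |C| := h2.trans (le_abs_self C)
  have hl : |l| ≤ |M| := by rw [abs_of_nonneg h3]; exact h4.trans (le_abs_self M)
  have hγx : ‖γ x‖ ≤ |A| := (hA x hx).trans (le_abs_self A)
  have hgx : |g x| ≤ |B| := (hB x hx).trans (le_abs_self B)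
  have hζ : |ζ| ≤ |C| + |B| * |M| := by
    calc |ζ| = |(ζ - g x * l) + g x * l| := by ring_nf
      _ ≤ |ζ - g x * l| + |g x * l| := abs_add_le _ _
      _ ≤ |C| + |B| * |M| := by
        rw [abs_mul]
        exact add_le_add (h5.trans (le_abs_self C))
          (mul_le_mul hgx hl (abs_nonneg _) (abs_nonneg _))
  have hξ : ‖ξ‖ ≤ |C| + |M| * |A| := by
    rw [h1]
    refine (norm_sub_le _ _).trans (add_le_add hv ?_)
    rw [norm_smul, Real.norm_eq_abs]
    exact mul_le_mul hl hγx (norm_nonneg _) (abs_nonneg _)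
  have p1 : 0 ≤ |M| * |A| := by positivity
  have p2 : 0 ≤ |B| * |M| := by positivity
  have p3 := abs_nonneg C
  have p4 := abs_nonneg M
  simp only [Prod.norm_mk, Real.norm_eq_abs]
  refine max_le ?_ (max_le ?_ (max_le ?_ ?_)) <;> linarith

end VelocitySet

/-! ### Choice of velocities from the supersolution property -/

section Selection

variable {Ω : Set (Space n)} {H : Space n → Space n → ℝ} {γ : Space n → Space n}
  {g φ : Space n → ℝ} {K : ℝ≥0}

theorem hasGradientAt_neg_mul_norm_sub_sq (N : ℝ) (x y : Space n) :
    HasGradientAt (fun x' : Space n => -(N * ‖y - x'‖ ^ 2)) ((2 * N) • (y - x)) x := by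
  refine hasGradientAt_iff_hasFDerivAt.2 ?_
  have h : HasFDerivAt (fun x' : Space n => y - x') (-ContinuousLinearMap.id ℝ (Space n)) x :=
    (hasFDerivAt_id x).const_sub y
  refine ((h.norm_sq.const_mul N).neg).congr_fderiv ?_
  ext e
  simp
  ring

/-- Slope of the Moreau envelope in feasible directions. -/
theorem inner_le_of_isMinOn (hφ : LipschitzOnWith K φ (closure Ω)) {N : ℝ} {x y e : Space n}
    (hx : x ∈ closure Ω) (hmin : IsMinOn (fun x' => φ x' + N * ‖y - x'‖ ^ 2) (closure Ω) x)
    (he : ∀ᶠ t in 𝓝[>] (0 : ℝ), x + t • e ∈ closure Ω) :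
    ⟪(2 * N) • (y - x), e⟫_ℝ ≤ K * ‖e‖ := by
  have hlim : Tendsto (fun t : ℝ => K * ‖e‖ + N * t * ‖e‖ ^ 2) (𝓝[>] 0) (𝓝 (K * ‖e‖)) := by
    have : Tendsto (fun t : ℝ => K * ‖e‖ + N * t * ‖e‖ ^ 2) (𝓝 0)
        (𝓝 (K * ‖e‖ + N * 0 * ‖e‖ ^ 2)) := Continuous.tendsto (by fun_prop) _
    rw [mul_zero, zero_mul, add_zero] at this
    exact this.mono_left nhdsWithin_le_nhds
  refine ge_of_tendsto hlim ?_
  filter_upwards [he, self_mem_nhdsWithin] with t ht ht0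
  have ht0' : (0 : ℝ) < t := ht0
  have h1 : φ x + N * ‖y - x‖ ^ 2 ≤ φ (x + t • e) + N * ‖y - (x + t • e)‖ ^ 2 := hmin ht
  have h2 := hφ.dist_le_mul _ ht _ hx
  rw [Real.dist_eq, dist_eq_norm, add_sub_cancel_left, norm_smul, Real.norm_eq_abs,
    abs_of_pos ht0'] at h2
  have h3 : ‖y - (x + t • e)‖ ^ 2 = ‖y - x‖ ^ 2 - 2 * (t * ⟪y - x, e⟫_ℝ) + t ^ 2 * ‖e‖ ^ 2 := by
    rw [show y - (x + t • e) = (y - x) - t • e by abel, norm_sub_sq_real, real_inner_smul_right,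
      norm_smul, mul_pow, Real.norm_eq_abs, sq_abs]
  rw [h3] at h1
  rw [real_inner_smul_left]
  have h4 : t * (2 * N * ⟪y - x, e⟫_ℝ) ≤ t * (K * ‖e‖ + N * t * ‖e‖ ^ 2) := by
    linarith [(le_abs_self _).trans h2]
  exact le_of_mul_le_mul_left h4 ht0'

/-- At a boundary point the slope of the Moreau envelope can be large only in the outer normal
direction, hence it is large in the oblique direction as well. -/
theorem le_inner_of_isMinOn (hφ : LipschitzOnWith K φ (closure Ω)) {N : ℝ} {x y ν : Space n}
    (hx : x ∈ closure Ω) (hmin : IsMinOn (fun x' => φ x' + N * ‖y - x'‖ ^ 2) (closure Ω) x)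
    (hν : IsOuterUnitNormal Ω x ν) {θ : Space n} {c A : ℝ} (hc : 0 < c) (hcθ : c ≤ ⟪ν, θ⟫_ℝ)
    (hA : ‖θ‖ ≤ A) (hbig : 2 * K < ‖(2 * N) • (y - x)‖) :
    c * ‖(2 * N) • (y - x)‖ - c * K - K * A ≤ ⟪(2 * N) • (y - x), θ⟫_ℝ := by
  obtain ⟨p, hp⟩ : ∃ p, p = (2 * N) • (y - x) := ⟨_, rfl⟩
  have hν1 := hν.norm_eq_one
  have hνν : ⟪ν, ν⟫_ℝ = 1 := by rw [real_inner_self_eq_norm_sq, hν1, one_pow]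
  have hlt : ∀ e, ⟪ν, e⟫_ℝ < 0 → ⟪p, e⟫_ℝ ≤ K * ‖e‖ := fun e he => by
    rw [hp]
    exact inner_le_of_isMinOn hφ hx hmin ((hν.eventually_mem he).mono fun _ h => subset_closure h)
  have hle : ∀ e, ⟪ν, e⟫_ℝ ≤ 0 → ⟪p, e⟫_ℝ ≤ K * ‖e‖ := by
    intro e he
    -- Tangential directions may leave the closure; tilt them inward and let the tilt vanish.
    have h1 : Tendsto (fun s : ℝ => ⟪p, e - s • ν⟫_ℝ) (𝓝[>] 0) (𝓝 ⟪p, e⟫_ℝ) := by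
      have : Tendsto (fun s : ℝ => ⟪p, e - s • ν⟫_ℝ) (𝓝 0) (𝓝 ⟪p, e - (0 : ℝ) • ν⟫_ℝ) :=
        Continuous.tendsto (by fun_prop) _
      rw [zero_smul, sub_zero] at this
      exact this.mono_left nhdsWithin_le_nhds
    have h2 : Tendsto (fun s : ℝ => K * ‖e - s • ν‖) (𝓝[>] 0) (𝓝 (K * ‖e‖)) := by
      have : Tendsto (fun s : ℝ => K * ‖e - s • ν‖) (𝓝 0) (𝓝 (K * ‖e - (0 : ℝ) • ν‖)) :=
        Continuous.tendsto (by fun_prop) _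
      rw [zero_smul, sub_zero] at this
      exact this.mono_left nhdsWithin_le_nhds
    refine le_of_tendsto_of_tendsto h1 h2 ?_
    filter_upwards [self_mem_nhdsWithin] with s hs
    have hs' : (0 : ℝ) < s := hs
    refine hlt _ ?_
    rw [inner_sub_right, real_inner_smul_right, hνν]
    linarith
  rw [← hp] at hbig ⊢
  set τ : ℝ := ⟪ν, p⟫_ℝ with hτ
  set q : Space n := p - τ • ν with hq
  have hνq : ⟪ν, q⟫_ℝ = 0 := by rw [hq, inner_sub_right, real_inner_smul_right, hνν]; linarith
  have hpq : p = q + τ • ν := by rw [hq]; abel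
  have hqK : ‖q‖ ≤ K := by
    rcases eq_or_ne q 0 with h0 | h0
    · rw [h0, norm_zero]; exact K.2
    have h1 := hle q hνq.le
    have h2 : ⟪p, q⟫_ℝ = ‖q‖ * ‖q‖ := by
      rw [hpq, inner_add_left, real_inner_smul_left, hνq, mul_zero, add_zero,
        real_inner_self_eq_norm_mul_norm]
    rw [h2] at h1
    exact le_of_mul_le_mul_right h1 (norm_pos_iff.2 h0)
  -- The inward normal is feasible. With the tangential part also bounded by `K`, a norm above `2 *
  -- K` forces `τ ≥ 0`.
  have hτK : -K ≤ τ := by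
    have h1 := hle (-ν) (by rw [inner_neg_right, hνν]; norm_num)
    rw [inner_neg_right, norm_neg, hν1, mul_one, real_inner_comm] at h1
    linarith
  have hpn : ‖p‖ ≤ K + |τ| := by
    calc ‖p‖ = ‖q + τ • ν‖ := by rw [← hpq]
      _ ≤ ‖q‖ + ‖τ • ν‖ := norm_add_le _ _
      _ ≤ K + |τ| := by rw [norm_smul, hν1, mul_one, Real.norm_eq_abs]; gcongr
  have hτ0 : 0 ≤ τ := by
    by_contra hneg
    rw [abs_of_neg (not_le.1 hneg)] at hpn
    linarith
  rw [abs_of_nonneg hτ0] at hpn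
  have hqθ : -(K * A) ≤ ⟪q, θ⟫_ℝ := by
    refine neg_le_of_abs_le ((abs_real_inner_le_norm _ _).trans ?_)
    gcongr
  have hpθ : ⟪p, θ⟫_ℝ = ⟪q, θ⟫_ℝ + τ * ⟪ν, θ⟫_ℝ := by
    conv_lhs => rw [hpq]
    rw [inner_add_left, real_inner_smul_left]
  have h1 : τ * c ≤ τ * ⟪ν, θ⟫_ℝ := mul_le_mul_of_nonneg_left hcθ hτ0
  have h2 : c * ‖p‖ ≤ c * (K + τ) := mul_le_mul_of_nonneg_left hpn hc.le
  rw [hpθ]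
  linarith

/-- The supersolution property gives, at a point realizing the Moreau envelope of `φ` at `y`, an
admissible velocity along which the envelope decreases at least at the rate of the running cost.
Lowering `g` by `ε` makes the reflection rate bounded. -/
theorem IsSupersolution.exists_velocity (hΩ : IsOpen Ω) (hbdd : Bornology.IsBounded Ω)
    (hC1 : HasC1Boundary Ω)
    (hH : ContinuousOn (fun q : Space n × Space n => H q.1 q.2) (closure Ω ×ˢ univ))
    (hconv : ∀ x ∈ closure Ω, ConvexOn ℝ univ (H x))
    (hγ : ContinuousOn γ (frontier Ω)) (hg : ContinuousOn g (frontier Ω)) (hobl : IsOblique Ω γ)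
    (hφ : LipschitzOnWith K φ (closure Ω)) (hsup : IsSupersolution Ω H γ g 0 φ) :
    ∃ C, ∀ ε > 0, ∃ M, ∀ N, ∀ x ∈ closure Ω, ∀ y,
      IsMinOn (fun x' => φ x' + N * ‖y - x'‖ ^ 2) (closure Ω) x →
      ∃ w ∈ velocitySet Ω H γ (fun x => g x - ε) C M x,
        ⟪(2 * N) • (y - x), w.1⟫_ℝ + w.2.2.2 ≤ 0 := by
  have hcomp : IsCompact (closure Ω) :=
    Metric.isCompact_of_isClosed_isBounded isClosed_closure hbdd.closure
  have hfcomp : IsCompact (frontier Ω) :=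
    hcomp.of_isClosed_subset isClosed_frontier frontier_subset_closure
  obtain ⟨c, hc, hν⟩ := hobl.exists_pos_le hΩ hbdd hC1 hγ
  obtain ⟨A, hA⟩ := hfcomp.exists_bound_of_continuousOn hγ
  obtain ⟨gm, hgm⟩ := hfcomp.exists_bound_of_continuousOn hg
  -- Beyond norm `R` the bound of `le_inner_of_isMinOn` leaves `γ·p - g ≥ (c/2)‖p‖ + 1`.
  obtain ⟨R, hR⟩ : ∃ R : ℝ, R = 2 * K + 2 * (c * K + K * |A| + |gm| + 1) / c := ⟨_, rfl⟩
  have hR2K : 2 * K ≤ R := by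
    have : 0 ≤ 2 * (c * K + K * |A| + |gm| + 1) / c := by positivity
    linarith
  have hR0 : 0 ≤ R := le_trans (by positivity) hR2K
  have hRc : 2 * (c * K + K * |A| + |gm| + 1) ≤ c * R := by
    have : c * (2 * (c * K + K * |A| + |gm| + 1) / c) = 2 * (c * K + K * |A| + |gm| + 1) := by
      field_simp
    have h2 : 0 ≤ c * (2 * K) := by positivity
    rw [hR, mul_add c, this]
    linarith
  obtain ⟨B, hB⟩ := (hcomp.prod (isCompact_closedBall (0 : Space n) (R + 1))).exists_bound_of_continuousOn
    (hH.mono (prod_mono_right (subset_univ _)))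
  have hB' : ∀ x ∈ closure Ω, ∀ q, ‖q‖ ≤ R + 1 → |H x q| ≤ |B| := fun x hx q hq =>
    (hB (x, q) ⟨hx, mem_closedBall_zero_iff.2 hq⟩).trans (le_abs_self B)
  have hcont : ∀ x ∈ closure Ω, Continuous (H x) := fun x hx => by
    rw [← continuousOn_univ]
    exact hH.comp (f := fun q : Space n => (x, q)) (Continuous.continuousOn (by fun_prop))
      fun q _ => ⟨hx, mem_univ _⟩
  obtain ⟨C, hC⟩ : ∃ C : ℝ, C = 2 * |B| * R + |B| + 2 * |B| := ⟨_, rfl⟩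
  have hB0 := abs_nonneg B
  have hBR : 0 ≤ 2 * |B| * R := by positivity
  have hC0 : 0 ≤ C := by linarith
  -- The two summands are the rates used for `‖p‖ ≤ R` and for `‖p‖ > R`. Only the first depends on
  -- `ε`.
  refine ⟨C, fun ε hε => ⟨|B| / ε + (2 * C / c + |B|), fun N x hx y hmin => ?_⟩⟩
  have hM1 : 0 ≤ |B| / ε := by positivity
  have hM2 : 0 ≤ 2 * C / c + |B| := by positivity
  obtain ⟨p, hp⟩ : ∃ p, p = (2 * N) • (y - x) := ⟨_, rfl⟩
  rw [← hp]
  -- the velocity built from a subgradient at `p'`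
  have hvel : ∀ p' l, ‖p'‖ ≤ R → 0 ≤ l → l ≤ |B| / ε + (2 * C / c + |B|) → (x ∈ Ω → l = 0) →
      ∃ ξ : Space n, ‖ξ‖ ≤ C ∧ ((-ξ - l • γ x, -ξ, l, ⟪ξ, p'⟫_ℝ - H x p' + (g x - ε) * l) : State n) ∈
        velocitySet Ω H γ (fun x => g x - ε) C (|B| / ε + (2 * C / c + |B|)) x := by
    intro p' l hp' hl hlM hlΩ
    obtain ⟨ξ, hξ⟩ := exists_subgradient (hconv x hx) (hcont x hx) p'
    have hξB := norm_le_of_subgradient hξ hp' (hB' x hx)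
    have hξC : ‖ξ‖ ≤ C := by linarith
    refine ⟨ξ, hξC, rfl, by rwa [norm_neg], hl, hlM, ?_, fun q => ?_, hlΩ⟩
    · dsimp only
      rw [add_sub_cancel_right]
      have h1 : |⟪ξ, p'⟫_ℝ| ≤ 2 * |B| * R :=
        (abs_real_inner_le_norm _ _).trans (mul_le_mul hξB hp' (norm_nonneg _) (by positivity))
      have h2 := hB' x hx p' (by linarith)
      exact (abs_sub _ _).trans (by linarith)
    · dsimp only
      rw [neg_neg]
      have h1 := hξ q
      rw [inner_sub_right] at h1
      linarith
  have htotal : ∀ (ξ : Space n) (l ζ : ℝ), ⟪p, -ξ - l • γ x⟫_ℝ + ζ = -⟪ξ, p⟫_ℝ - l * ⟪γ x, p⟫_ℝ + ζ := by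
    intro ξ l ζ
    rw [inner_sub_right, inner_neg_right, real_inner_smul_right, real_inner_comm,
      real_inner_comm (γ x) p]
  have hψ : ContDiff ℝ 1 fun x' : Space n => -(N * ‖y - x'‖ ^ 2) :=
    (contDiff_const.mul ((contDiff_const.sub contDiff_id).norm_sq ℝ)).neg
  have hmin' : IsMinOn (fun x' => φ x' - -(N * ‖y - x'‖ ^ 2)) (closure Ω) x := by
    simpa only [sub_neg_eq_add] using hmin
  have hgrad : gradient (fun x' : Space n => -(N * ‖y - x'‖ ^ 2)) x = p := by
    rw [hp]; exact (hasGradientAt_neg_mul_norm_sub_sq N x y).gradient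
  by_cases hpR : ‖p‖ ≤ R
  -- With a subgradient at `p` the total is `-H x p - l * (⟪γ x, p⟫ - g x + ε)`. Take `l = 0` if `H
  -- x p ≥ 0`, and `l = -H x p / ε` otherwise.
  · by_cases hHp : 0 ≤ H x p
    · obtain ⟨ξ, -, hw⟩ := hvel p 0 hpR le_rfl (by positivity) fun _ => rfl
      refine ⟨_, hw, ?_⟩
      dsimp only
      rw [htotal]
      linarith
    · have hf : x ∈ frontier Ω := by
        rw [hΩ.frontier_eq]
        refine ⟨hx, fun hxΩ => hHp ?_⟩
        have := hsup.interior_test x hxΩ _ hψ hmin'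
        rwa [hgrad] at this
      have hγp : g x ≤ ⟪γ x, p⟫_ℝ := by
        have := hsup.boundary_test x hf _ hψ hmin'
        rw [hgrad] at this
        exact this.resolve_left hHp
      have hHB := hB' x hx p (by linarith)
      have hl0 : 0 ≤ -H x p / ε := div_nonneg (by linarith) hε.le
      have hle : -H x p / ε ≤ |B| / ε :=
        div_le_div_of_nonneg_right ((neg_le_abs _).trans hHB) hε.le
      obtain ⟨ξ, -, hw⟩ := hvel p (-H x p / ε) hpR hl0 (by linarith)
        fun h => absurd h (hΩ.frontier_eq ▸ hf : x ∈ closure Ω \ Ω).2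
      refine ⟨_, hw, ?_⟩
      dsimp only
      rw [htotal]
      have h1 : -H x p / ε * ε = -H x p := div_mul_cancel₀ _ hε.ne'
      have h2 := mul_le_mul_of_nonneg_left hγp hl0
      linarith
  · rw [not_le] at hpR
    have hf : x ∈ frontier Ω := by
      rw [hΩ.frontier_eq]
      refine ⟨hx, fun hxΩ => ?_⟩
      have hev : ∀ᶠ t in 𝓝[>] (0 : ℝ), x + t • p ∈ closure Ω := by
        have h1 : Tendsto (fun t : ℝ => x + t • p) (𝓝 0) (𝓝 (x + (0 : ℝ) • p)) :=
          Continuous.tendsto (by fun_prop) _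
        rw [zero_smul, add_zero] at h1
        exact ((h1.mono_left nhdsWithin_le_nhds).eventually (hΩ.mem_nhds hxΩ)).mono
          fun _ h => subset_closure h
      have h2 := inner_le_of_isMinOn hφ hx hmin hev
      rw [← hp, real_inner_self_eq_norm_mul_norm] at h2
      have h3 : 0 < ‖p‖ := by linarith
      have h4 : ‖p‖ ≤ K := le_of_mul_le_mul_right h2 h3
      have h5 := K.2
      change 0 ≤ (K : ℝ) at h5
      linarith
    obtain ⟨ν, hν1, hν2⟩ := hν x hf
    have hγp := le_inner_of_isMinOn hφ hx hmin hν1 hc hν2 ((hA x hf).trans (le_abs_self A))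
      (by rw [← hp]; linarith)
    rw [← hp] at hγp
    -- A subgradient at `p` would not be bounded uniformly here. One at `0` costs at most `C * ‖p‖ +
    -- |B|`, which this reflection rate outweighs.
    obtain ⟨ξ, hξC, hw⟩ := hvel 0 (2 * C / c + |B|) (by simpa using hR0) hM2 (by linarith)
      fun h => absurd h (hΩ.frontier_eq ▸ hf : x ∈ closure Ω \ Ω).2
    refine ⟨_, hw, ?_⟩
    dsimp only
    rw [htotal, inner_zero_right]
    have hgx : g x ≤ |gm| := ((le_abs_self _).trans (hgm x hf)).trans (le_abs_self gm)
    have hcp : c * R ≤ c * ‖p‖ := mul_le_mul_of_nonneg_left hpR.le hc.le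
    have hlow : c / 2 * ‖p‖ + 1 ≤ ⟪γ x, p⟫_ℝ - (g x - ε) := by
      rw [real_inner_comm]
      linarith
    have hmul := mul_le_mul_of_nonneg_left hlow hM2
    have hexp : C * ‖p‖ + |B| ≤ (2 * C / c + |B|) * (c / 2 * ‖p‖ + 1) := by
      have e1 : (2 * C / c + |B|) * (c / 2 * ‖p‖ + 1) =
          C * ‖p‖ + |B| + (2 * C / c + |B| * (c / 2) * ‖p‖) := by field_simp; ring
      have e2 : 0 ≤ 2 * C / c + |B| * (c / 2) * ‖p‖ := by positivity
      linarith
    have hξp : -⟪ξ, p⟫_ℝ ≤ C * ‖p‖ :=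
      (neg_le_abs _).trans ((abs_real_inner_le_norm _ _).trans
        (mul_le_mul_of_nonneg_right hξC (norm_nonneg _)))
    have hH0 := (abs_le.1 (hB' x hx 0 (by simpa using (by linarith : (0 : ℝ) ≤ R + 1)))).1
    linarith

end Selection

/-! ### The explicit Euler scheme -/

section Euler

variable {W : Type*} [NormedAddCommGroup W] [NormedSpace ℝ W]

/-- The explicit Euler scheme with step `h`. -/
def eulerSeq (f : W → W) (h : ℝ) (Y₀ : W) : ℕ → W
  | 0 => Y₀
  | j + 1 => eulerSeq f h Y₀ j + h • f (eulerSeq f h Y₀ j)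

/-- The step function of the Euler scheme. -/
def eulerStep (f : W → W) (h : ℝ) (Y₀ : W) (t : ℝ) : W := eulerSeq f h Y₀ ⌊t / h⌋₊

variable {f : W → W} {h : ℝ} {Y₀ : W} {R : ℝ}

theorem norm_eulerSeq_sub_le (hh : 0 ≤ h) (hf : ∀ y, ‖f y‖ ≤ R) {i j : ℕ} (hij : i ≤ j) :
    ‖eulerSeq f h Y₀ j - eulerSeq f h Y₀ i‖ ≤ R * (h * (j - i)) := by
  induction j, hij using Nat.le_induction with
  | base => simp
  | succ j hij ih =>
    have h1 : eulerSeq f h Y₀ (j + 1) - eulerSeq f h Y₀ i =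
        (eulerSeq f h Y₀ j - eulerSeq f h Y₀ i) + h • f (eulerSeq f h Y₀ j) := by
      rw [eulerSeq]; abel
    rw [h1]
    refine (norm_add_le _ _).trans ?_
    rw [norm_smul, Real.norm_eq_abs, abs_of_nonneg hh]
    have := mul_le_mul_of_nonneg_left (hf (eulerSeq f h Y₀ j)) hh
    push_cast
    linarith

theorem mul_floor_sub_floor_le (hh : 0 < h) {s t : ℝ} (hst : s ≤ t) :
    h * ((⌊t / h⌋₊ : ℝ) - ⌊s / h⌋₊) ≤ t - s + h := by
  have h1 : s / h < ⌊s / h⌋₊ + 1 := Nat.lt_floor_add_one _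
  rw [div_lt_iff₀ hh] at h1
  rcases le_total 0 t with ht | ht
  · have h2 : (⌊t / h⌋₊ : ℝ) ≤ t / h := Nat.floor_le (by positivity)
    rw [le_div_iff₀ hh] at h2
    linarith
  · rw [Nat.floor_of_nonpos (div_nonpos_of_nonpos_of_nonneg ht hh.le),
      Nat.floor_of_nonpos (div_nonpos_of_nonpos_of_nonneg (hst.trans ht) hh.le)]
    simp only [sub_self, mul_zero]
    linarith

theorem le_mul_floor_sub_floor (hh : 0 < h) {s t : ℝ} (hs : 0 ≤ s) :
    t - s - h ≤ h * ((⌊t / h⌋₊ : ℝ) - ⌊s / h⌋₊) := by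
  have h1 : t / h < ⌊t / h⌋₊ + 1 := Nat.lt_floor_add_one _
  have h2 : (⌊s / h⌋₊ : ℝ) ≤ s / h := Nat.floor_le (by positivity)
  rw [div_lt_iff₀ hh] at h1
  rw [le_div_iff₀ hh] at h2
  linarith

theorem norm_eulerStep_sub_le (hh : 0 < h) (hf : ∀ y, ‖f y‖ ≤ R) (s t : ℝ) :
    ‖eulerStep f h Y₀ t - eulerStep f h Y₀ s‖ ≤ R * |t - s| + R * h := by
  have hR : 0 ≤ R := (norm_nonneg _).trans (hf Y₀)
  wlog hst : s ≤ t generalizing s t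
  · rw [norm_sub_rev, abs_sub_comm]
    exact this t s (le_of_not_ge hst)
  refine (norm_eulerSeq_sub_le hh.le hf
    (Nat.floor_mono (div_le_div_of_nonneg_right hst hh.le))).trans ?_
  rw [abs_of_nonneg (sub_nonneg.2 hst), ← mul_add]
  exact mul_le_mul_of_nonneg_left (mul_floor_sub_floor_le hh hst) hR

theorem eulerStep_of_nonpos (hh : 0 < h) {t : ℝ} (ht : t ≤ 0) : eulerStep f h Y₀ t = Y₀ := by
  rw [eulerStep, Nat.floor_of_nonpos (div_nonpos_of_nonpos_of_nonneg ht hh.le)]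
  rfl

theorem eulerStep_natCast_mul (hh : 0 < h) (j : ℕ) :
    eulerStep f h Y₀ (j * h) = eulerSeq f h Y₀ j := by
  rw [eulerStep, mul_div_cancel_right₀ _ hh.ne', Nat.floor_natCast]

/-- Half-space estimates for the increments of the Euler scheme. -/
theorem map_eulerStep_sub_le (hh : 0 < h) (F : W →L[ℝ] ℝ) {c s t : ℝ} (hs : 0 ≤ s) (hst : s ≤ t)
    (hF : ∀ τ ∈ Icc s t, F (f (eulerStep f h Y₀ τ)) ≤ c) :
    F (eulerStep f h Y₀ t - eulerStep f h Y₀ s) ≤ c * (t - s) + |c| * h := by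
  have hfl : ⌊s / h⌋₊ ≤ ⌊t / h⌋₊ := Nat.floor_mono (div_le_div_of_nonneg_right hst hh.le)
  have key : ∀ j, ⌊s / h⌋₊ ≤ j → j ≤ ⌊t / h⌋₊ →
      F (eulerSeq f h Y₀ j - eulerSeq f h Y₀ ⌊s / h⌋₊) ≤ c * (h * (j - ⌊s / h⌋₊)) := by
    intro j hj
    induction j, hj using Nat.le_induction with
    | base => intro _; simp
    | succ j hj ih =>
      intro hjt
      have hF' : F (f (eulerSeq f h Y₀ j)) ≤ c := by
        -- Only the first node can precede `s`, and there the step function has the same value as at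
        -- `s`, where the hypothesis applies.
        rcases le_or_gt ((j : ℝ) * h) s with hjs | hjs
        · have : j = ⌊s / h⌋₊ :=
            le_antisymm (Nat.le_floor ((le_div_iff₀ hh).2 hjs)) hj
          rw [this]
          exact hF s ⟨le_rfl, hst⟩
        · rw [← eulerStep_natCast_mul hh j]
          refine hF _ ⟨hjs.le, ?_⟩
          have h1 : ((j : ℝ) + 1) ≤ t / h := by
            have := (Nat.cast_le (α := ℝ)).2 hjt
            push_cast at this
            exact this.trans (Nat.floor_le (div_nonneg (hs.trans hst) hh.le))
          rw [le_div_iff₀ hh] at h1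
          linarith
      have h1 : eulerSeq f h Y₀ (j + 1) - eulerSeq f h Y₀ ⌊s / h⌋₊ =
          (eulerSeq f h Y₀ j - eulerSeq f h Y₀ ⌊s / h⌋₊) + h • f (eulerSeq f h Y₀ j) := by
        rw [eulerSeq]; abel
      rw [h1, map_add, map_smul, smul_eq_mul]
      have h2 := ih (by omega)
      have h3 := mul_le_mul_of_nonneg_left hF' hh.le
      push_cast
      linarith
  refine (key _ hfl le_rfl).trans ?_
  have h1 := mul_floor_sub_floor_le hh hst
  have h2 := le_mul_floor_sub_floor (t := t) hh hs
  have h3 : |h * ((⌊t / h⌋₊ : ℝ) - ⌊s / h⌋₊) - (t - s)| ≤ h := abs_le.2 ⟨by linarith, by linarith⟩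
  have h4 : c * (h * ((⌊t / h⌋₊ : ℝ) - ⌊s / h⌋₊) - (t - s)) ≤ |c| * h := by
    refine (le_abs_self _).trans ?_
    rw [abs_mul]
    exact mul_le_mul_of_nonneg_left h3 (abs_nonneg c)
  linarith

end Euler

/-! ### Trajectories from the Moreau envelopes -/

section Construction

variable {Ω : Set (Space n)} {H : Space n → Space n → ℝ} {γ : Space n → Space n}
  {g φ : Space n → ℝ} {K : ℝ≥0} {C M : ℝ}

/-- Limits of approximate trajectories for the velocity sets. -/
theorem exists_trajectory_velocitySet (hΩ : IsOpen Ω) (hbdd : Bornology.IsBounded Ω)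
    (hH : ContinuousOn (fun q : Space n × Space n => H q.1 q.2) (closure Ω ×ˢ univ))
    (hγ : Continuous γ) (hg : Continuous g)
    (Y : ℕ → ℝ → State n) (Y₀ : State n) (R : ℝ≥0) (e : ℕ → ℝ) (he : Tendsto e atTop (𝓝 0))
    (hY0 : ∀ k t, t ≤ 0 → Y k t = Y₀)
    (hlip : ∀ k s t, ‖Y k t - Y k s‖ ≤ R * |t - s| + e k)
    (hnear : ∀ t, 0 ≤ t → ∀ δ > 0, ∀ᶠ k in atTop, ∃ x ∈ closure Ω, ‖x - (Y k t).1‖ ≤ δ)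
    (hinc : ∀ (f : State n →L[ℝ] ℝ) (c s t δ : ℝ), 0 ≤ s → s ≤ t → 0 < δ → ∀ᶠ k in atTop,
      (∀ τ ∈ Icc s t, ∀ x ∈ closure Ω, ‖x - (Y k τ).1‖ ≤ δ →
        ∀ w ∈ velocitySet Ω H γ g C M x, f w ≤ c) → f (Y k t - Y k s) ≤ c * (t - s) + δ) :
    ∃ Z : ℝ → State n, LipschitzWith R Z ∧ (∀ t ≤ 0, Z t = Y₀) ∧
      (∀ t, 0 ≤ t → (Z t).1 ∈ closure Ω) ∧
      (∀ t, Tendsto (fun k => Y k t) (hyperfilter ℕ) (𝓝 (Z t))) ∧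
      ∀ t, 0 < t → ∀ w, HasDerivAt Z w t → w ∈ velocitySet Ω H γ g C M (Z t).1 := by
  obtain ⟨R', hR'⟩ := exists_norm_le_of_mem_velocitySet (C := C) (M := M) (H := H) hbdd hγ hg
  have hlift : ∀ {k : ℕ} {t δ : ℝ} {x : Space n}, ‖x - (Y k t).1‖ ≤ δ →
      ‖((x, (Y k t).2) : State n) - Y k t‖ ≤ δ := by
    intro k t δ x hx
    have : ((x, (Y k t).2) : State n) - Y k t = (x - (Y k t).1, 0) := by
      ext1 <;> simp
    rw [this, Prod.norm_mk, norm_zero, max_eq_left (norm_nonneg _)]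
    exact hx
  refine exists_trajectory_of_approx (D := {y : State n | y.1 ∈ closure Ω})
    (G := fun y => velocitySet Ω H γ g C M y.1) (isClosed_closure.preimage continuous_fst)
    (fun y _ => convex_velocitySet y.1) (fun y hy => isClosed_velocitySet hΩ hH hγ hg hy)
    ?_ Y Y₀ R e he hY0 hlip ?_ ?_
  · intro y₀ _ f c h
    have h1 := eventually_forall_lt_of_isClosed_graph (isCompact_closedBall (0 : State n) R')
      (fun x hx w hw => mem_closedBall_zero_iff.2 (hR' x hx w hw))
      (isClosed_graph_velocitySet (C := C) (M := M) hΩ hH hγ hg) f c h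
    have h2 : Tendsto (fun y : State n => y.1) (𝓝[{y | y.1 ∈ closure Ω}] y₀)
        (𝓝[closure Ω] y₀.1) :=
      tendsto_nhdsWithin_iff.2 ⟨(continuous_fst.tendsto _).mono_left nhdsWithin_le_nhds,
        eventually_mem_nhdsWithin⟩
    exact h2.eventually h1
  · intro t ht δ hδ
    filter_upwards [hnear t ht δ hδ] with k ⟨x, hx, hxδ⟩
    exact ⟨(x, (Y k t).2), hx, hlift hxδ⟩
  · intro f c s t δ hs hst hδ
    filter_upwards [hinc f c s t δ hs hst hδ] with k hk hyp
    exact hk fun τ hτ x hx hxδ w hw => hyp τ hτ (x, (Y k τ).2) hx (hlift hxδ) w hw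

/-- A solution of the reflected differential inclusion along which `φ` decreases at least at the
rate of the cost, obtained from the Euler scheme for the Moreau envelopes of `φ`. -/
theorem exists_trajectory_of_selection (hΩ : IsOpen Ω) (hbdd : Bornology.IsBounded Ω)
    (hH : ContinuousOn (fun q : Space n × Space n => H q.1 q.2) (closure Ω ×ˢ univ))
    (hγ : Continuous γ) (hg : Continuous g) (hφ : LipschitzOnWith K φ (closure Ω))
    (hsel : ∀ N, ∀ x ∈ closure Ω, ∀ y,
      IsMinOn (fun x' => φ x' + N * ‖y - x'‖ ^ 2) (closure Ω) x →
      ∃ w ∈ velocitySet Ω H γ g C M x, ⟪(2 * N) • (y - x), w.1⟫_ℝ + w.2.2.2 ≤ 0)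
    {x₀ : Space n} (hx₀ : x₀ ∈ closure Ω) :
    ∃ (Z : ℝ → State n) (R : ℝ≥0), LipschitzWith R Z ∧ (∀ t ≤ 0, Z t = (x₀, 0, 0, 0)) ∧
      (∀ t, 0 ≤ t → (Z t).1 ∈ closure Ω) ∧
      (∀ t, 0 < t → ∀ w, HasDerivAt Z w t → w ∈ velocitySet Ω H γ g C M (Z t).1) ∧
      ∀ t, 0 ≤ t → φ (Z t).1 + (Z t).2.2.2 ≤ φ x₀ := by
  have hcomp : IsCompact (closure Ω) :=
    Metric.isCompact_of_isClosed_isBounded isClosed_closure hbdd.closure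
  obtain ⟨R, hR⟩ := exists_norm_le_of_mem_velocitySet (C := C) (M := M) (H := H) hbdd hγ hg
  obtain ⟨B, hB⟩ := hcomp.exists_bound_of_continuousOn hφ.continuousOn
  have hminex : ∀ (N : ℝ) (y : Space n), ∃ x ∈ closure Ω,
      IsMinOn (fun x' => φ x' + N * ‖y - x'‖ ^ 2) (closure Ω) x := fun N y =>
    hcomp.exists_isMinOn ⟨x₀, hx₀⟩
      (hφ.continuousOn.add (Continuous.continuousOn (by fun_prop)))
  choose ξ hξ hξmin using hminex
  choose w hw hwle using fun N y => hsel N (ξ N y) (hξ N y) y (hξmin N y)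
  let N : ℕ → ℝ := fun k => (k : ℝ) + 1
  -- The step is `N⁻²`: the quadratic error `N h² R²` per step adds up over time `t` to at most `t
  -- R² / N`.
  let h : ℕ → ℝ := fun k => (((k : ℝ) + 1) ^ 2)⁻¹
  have hN : ∀ k, 0 < N k := fun k => by positivity
  have hh : ∀ k, 0 < h k := fun k => by positivity
  have hNh : ∀ k, N k * h k = (N k)⁻¹ := fun k => by
    change N k * (N k ^ 2)⁻¹ = (N k)⁻¹
    have := (hN k).ne'
    field_simp
  have hNt : Tendsto N atTop atTop := tendsto_natCast_atTop_atTop.atTop_add tendsto_const_nhds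
  have hht : Tendsto h atTop (𝓝 0) :=
    tendsto_inv_atTop_zero.comp ((tendsto_pow_atTop two_ne_zero).comp hNt)
  let f : ℕ → State n → State n := fun k y => w (N k) y.1
  have hf : ∀ k y, ‖f k y‖ ≤ R := fun k y => hR _ (hξ _ _) _ (hw _ _)
  let Y₀ : State n := (x₀, 0, 0, 0)
  let S : ℕ → ℕ → State n := fun k => eulerSeq (f k) (h k) Y₀
  let Y : ℕ → ℝ → State n := fun k => eulerStep (f k) (h k) Y₀
  -- the energy estimate
  have henergy : ∀ k j, φ (ξ (N k) (S k j).1) + N k * ‖(S k j).1 - ξ (N k) (S k j).1‖ ^ 2 +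
      (S k j).2.2.2 ≤ φ x₀ + j * h k * ((N k)⁻¹ * R ^ 2) := by
    intro k j
    induction j with
    | zero =>
      have h1 : φ (ξ (N k) x₀) + N k * ‖x₀ - ξ (N k) x₀‖ ^ 2 ≤ φ x₀ + N k * ‖x₀ - x₀‖ ^ 2 :=
        hξmin (N k) x₀ hx₀
      have h2 : S k 0 = (x₀, 0, 0, 0) := rfl
      rw [h2]
      simpa using h1
    | succ j ih =>
      obtain ⟨y, hy⟩ : ∃ y, y = S k j := ⟨_, rfl⟩
      have h2 : S k (j + 1) = y + h k • f k y := by rw [hy]; rfl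
      -- The old minimiser is a competitor at the new point. Expanding the square leaves the
      -- selected inequality plus the quadratic error.
      have h1 : φ (ξ (N k) (S k (j + 1)).1) +
          N k * ‖(S k (j + 1)).1 - ξ (N k) (S k (j + 1)).1‖ ^ 2 ≤
          φ (ξ (N k) y.1) + N k * ‖(S k (j + 1)).1 - ξ (N k) y.1‖ ^ 2 :=
        hξmin (N k) _ (hξ _ _)
      rw [← hy] at ih
      have h3 : (S k (j + 1)).1 - ξ (N k) y.1 = (y.1 - ξ (N k) y.1) + h k • (f k y).1 := by
        rw [h2, Prod.fst_add, Prod.smul_fst]; abel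
      have h4 : (S k (j + 1)).2.2.2 = y.2.2.2 + h k * (f k y).2.2.2 := by
        rw [h2]; simp
      have h5 : ‖(S k (j + 1)).1 - ξ (N k) y.1‖ ^ 2 = ‖y.1 - ξ (N k) y.1‖ ^ 2 +
          2 * (h k * ⟪y.1 - ξ (N k) y.1, (f k y).1⟫_ℝ) + h k ^ 2 * ‖(f k y).1‖ ^ 2 := by
        rw [h3, norm_add_sq_real, real_inner_smul_right, norm_smul, mul_pow, Real.norm_eq_abs,
          sq_abs]
      have h6 : ‖(f k y).1‖ ^ 2 ≤ R ^ 2 :=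
        pow_le_pow_left₀ (norm_nonneg _) ((norm_fst_le _).trans (hf k y)) 2
      have h7 : 2 * N k * ⟪y.1 - ξ (N k) y.1, (f k y).1⟫_ℝ + (f k y).2.2.2 ≤ 0 := by
        have := hwle (N k) y.1
        rwa [real_inner_smul_left] at this
      have h8 := mul_le_mul_of_nonneg_left h7 (hh k).le
      have h9 : N k * (h k ^ 2 * ‖(f k y).1‖ ^ 2) ≤ h k * ((N k)⁻¹ * R ^ 2) := by
        rw [← hNh k]
        have := mul_le_mul_of_nonneg_left h6 (show 0 ≤ N k * h k ^ 2 by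
          have := hN k; have := hh k; positivity)
        linarith
      rw [h5] at h1
      rw [h4]
      push_cast
      linarith
  have hNinv : ∀ k, (N k)⁻¹ ≤ 1 := fun k => inv_le_one_of_one_le₀ (by
    change (1 : ℝ) ≤ k + 1
    linarith [(Nat.cast_nonneg k : (0 : ℝ) ≤ k)])
  have hlip : ∀ k s t, ‖Y k t - Y k s‖ ≤ R * |t - s| + R * h k := fun k s t =>
    norm_eulerStep_sub_le (hh k) (hf k) s t
  have hY0 : ∀ k t, t ≤ 0 → Y k t = Y₀ := fun k t ht => eulerStep_of_nonpos (hh k) ht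
  have henergyY : ∀ k t, 0 ≤ t → φ (ξ (N k) (Y k t).1) +
      N k * ‖(Y k t).1 - ξ (N k) (Y k t).1‖ ^ 2 + (Y k t).2.2.2 ≤
        φ x₀ + t * R ^ 2 * (N k)⁻¹ := by
    intro k t ht
    refine (henergy k ⌊t / h k⌋₊).trans ?_
    have h1 : (⌊t / h k⌋₊ : ℝ) * h k ≤ t := by
      rw [← le_div_iff₀ (hh k)]; exact Nat.floor_le (div_nonneg ht (hh k).le)
    have h2 := mul_le_mul_of_nonneg_right h1 (show 0 ≤ (N k)⁻¹ * (R : ℝ) ^ 2 by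
      have := hN k; positivity)
    linarith
  have hh1 : ∀ k, h k ≤ 1 := fun k => by
    have h1 : h k = (N k)⁻¹ ^ 2 := by change (N k ^ 2)⁻¹ = _; rw [inv_pow]
    rw [h1]
    exact pow_le_one₀ (inv_nonneg.2 (hN k).le) (hNinv k)
  -- The nodes themselves may lie outside the closure. The penalty is bounded because `φ` and the
  -- cost are, so nodes approach their minimisers, where the velocities are admissible.
  have hdist : ∀ k t, 0 ≤ t → ‖ξ (N k) (Y k t).1 - (Y k t).1‖ ^ 2 ≤
      (2 * B + (R * t + R) + t * R ^ 2) / N k := by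
    intro k t ht
    rw [le_div_iff₀ (hN k), norm_sub_rev]
    have h1 := henergyY k t ht
    have h2 := (abs_le.1 (hB _ (hξ (N k) (Y k t).1))).1
    have h3 := (abs_le.1 (hB _ hx₀)).2
    have h4 : -(R * t + R) ≤ (Y k t).2.2.2 := by
      have h5 := hlip k 0 t
      rw [hY0 k 0 le_rfl, sub_zero, abs_of_nonneg ht] at h5
      have h6 : |(Y k t).2.2.2| ≤ ‖Y k t - Y₀‖ := by
        have : (Y k t).2.2.2 = (Y k t - Y₀).2.2.2 := by simp [Y₀]
        rw [this, ← Real.norm_eq_abs]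
        exact (norm_snd_le _).trans ((norm_snd_le _).trans (norm_snd_le _))
      have h7 : R * h k ≤ R * 1 := mul_le_mul_of_nonneg_left (hh1 k) R.2
      have := (abs_le.1 (h6.trans h5)).1
      linarith
    have h8 : t * R ^ 2 * (N k)⁻¹ ≤ t * R ^ 2 := mul_le_of_le_one_right (by positivity) (hNinv k)
    linarith
  have hsmall : ∀ T δ, 0 ≤ T → 0 < δ → ∀ᶠ k in atTop, ∀ t ∈ Icc 0 T,
      ‖ξ (N k) (Y k t).1 - (Y k t).1‖ ≤ δ := by
    intro T δ hT hδ
    have h1 : Tendsto (fun k => (2 * B + (R * T + R) + T * R ^ 2) / N k) atTop (𝓝 0) :=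
      hNt.const_div_atTop _
    filter_upwards [h1.eventually (ge_mem_nhds (show 0 < δ ^ 2 by positivity))] with k hk t ht
    refine (pow_le_pow_iff_left₀ (norm_nonneg _) hδ.le two_ne_zero).1
      ((hdist k t ht.1).trans (le_trans ?_ hk))
    have := hN k
    have := ht.2
    gcongr
  obtain ⟨Z, hZ1, hZ2, hZ3, hZ4, hZ5⟩ := exists_trajectory_velocitySet (C := C) (M := M) hΩ hbdd hH
    hγ hg Y Y₀ R (fun k => R * h k) (by simpa using hht.const_mul (R : ℝ)) hY0 hlip
    (fun t ht δ hδ => (hsmall t δ ht hδ).mono fun k hk =>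
      ⟨_, hξ (N k) (Y k t).1, hk t ⟨ht, le_rfl⟩⟩)
    (by
      intro F c s t δ hs hst hδ
      have h1 : Tendsto (fun k => |c| * h k) atTop (𝓝 0) := by simpa using hht.const_mul |c|
      filter_upwards [hsmall t δ (hs.trans hst) hδ, h1.eventually (ge_mem_nhds hδ)]
        with k hk1 hk2 hyp
      refine (map_eulerStep_sub_le (hh k) F hs hst fun τ hτ => ?_).trans
        (add_le_add_right hk2 _)
      exact hyp τ hτ _ (hξ (N k) (Y k τ).1) (hk1 τ ⟨hs.trans hτ.1, hτ.2⟩) _ (hw _ _))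
  refine ⟨Z, R, hZ1, hZ2, hZ3, hZ5, fun t ht => ?_⟩
  have hU : (hyperfilter ℕ : Filter ℕ) ≤ atTop := by
    rw [← Nat.cofinite_eq_atTop]; exact hyperfilter_le_cofinite
  have hY1 : Tendsto (fun k => (Y k t).1) (hyperfilter ℕ) (𝓝 (Z t).1) :=
    (continuous_fst.tendsto _).comp (hZ4 t)
  have hY4 : Tendsto (fun k => (Y k t).2.2.2) (hyperfilter ℕ) (𝓝 (Z t).2.2.2) :=
    ((continuous_snd.comp (continuous_snd.comp continuous_snd)).tendsto _).comp (hZ4 t)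
  have hdiff : Tendsto (fun k => ξ (N k) (Y k t).1 - (Y k t).1) atTop (𝓝 0) := by
    rw [Metric.tendsto_nhds]
    intro ε hε
    filter_upwards [hsmall t (ε / 2) ht (half_pos hε)] with k hk
    rw [dist_zero_right]
    exact (hk t ⟨ht, le_rfl⟩).trans_lt (half_lt_self hε)
  have hξt : Tendsto (fun k => ξ (N k) (Y k t).1) (hyperfilter ℕ) (𝓝[closure Ω] (Z t).1) := by
    refine tendsto_nhdsWithin_iff.2 ⟨?_, .of_forall fun k => hξ _ _⟩
    have := (hdiff.mono_left hU).add hY1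
    simpa using this
  have hlim1 := ((hφ.continuousOn _ (hZ3 t ht)).tendsto.comp hξt).add hY4
  have hlim2 : Tendsto (fun k => φ x₀ + t * R ^ 2 * (N k)⁻¹) (hyperfilter ℕ) (𝓝 (φ x₀)) := by
    have := ((tendsto_inv_atTop_zero.comp hNt).const_mul (t * R ^ 2)).const_add (φ x₀)
    simp only [mul_zero, add_zero] at this
    exact this.mono_left hU
  refine le_of_tendsto_of_tendsto' hlim1 hlim2 fun k => ?_
  have h1 := henergyY k t ht
  have h2 : 0 ≤ N k * ‖(Y k t).1 - ξ (N k) (Y k t).1‖ ^ 2 := by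
    have := hN k; positivity
  simp only [Function.comp_apply]
  linarith

end Construction

/-! ### Lipschitz curves controlled by their derivatives -/

section Lipschitz

variable {W : Type*} [NormedAddCommGroup W] [NormedSpace ℝ W]

theorem map_sub_le_of_ae_hasDerivAt [FiniteDimensional ℝ W] {Y : ℝ → W} {K : ℝ≥0}
    (hY : LipschitzWith K Y) (F : W →L[ℝ] ℝ) {a b c : ℝ} (hab : a ≤ b)
    (h : ∀ t ∈ Ioc a b, ∀ w, HasDerivAt Y w t → F w ≤ c) : F (Y b - Y a) ≤ c * (b - a) := by
  rw [map_sub]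
  refine sub_le_of_ae_deriv_le (f := fun t => F (Y t)) (F.lipschitz.comp hY) hab ?_
  filter_upwards [hY.ae_differentiableAt_real] with t ht hab
  have h1 : HasDerivAt (fun t => F (Y t)) (F (deriv Y t)) t :=
    F.hasFDerivAt.comp_hasDerivAt t ht.hasDerivAt
  rw [h1.deriv]
  exact h t hab _ ht.hasDerivAt

/-- Apply the scalar estimate to a norming functional. It trades a Lipschitz constant that
degenerates with `ε` for the uniform bound on velocities. -/
theorem norm_sub_le_of_hasDerivAt [FiniteDimensional ℝ W] {Y : ℝ → W} {K R : ℝ≥0}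
    (hY : LipschitzWith K Y) {a b : ℝ} (hab : a ≤ b)
    (h : ∀ t ∈ Ioc a b, ∀ w, HasDerivAt Y w t → ‖w‖ ≤ R) : ‖Y b - Y a‖ ≤ R * (b - a) := by
  obtain ⟨F, hF1, hF2⟩ := exists_dual_vector'' ℝ (Y b - Y a)
  have h1 := map_sub_le_of_ae_hasDerivAt hY F hab (c := R) fun t ht w hw =>
    (le_abs_self _).trans ((F.le_of_opNorm_le hF1 w).trans (by rw [one_mul]; exact h t ht w hw))
  rw [hF2] at h1
  exact h1

end Lipschitz

/-! ### Removal of the perturbation of `g` -/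

section Construction

variable {Ω : Set (Space n)} {H : Space n → Space n → ℝ} {γ : Space n → Space n}
  {g φ : Space n → ℝ} {K : ℝ≥0}

/-- A solution of the reflected differential inclusion along which `φ` decreases at least at the
rate of the cost, for a supersolution `φ`. -/
theorem IsSupersolution.exists_trajectory (hΩ : IsOpen Ω) (hbdd : Bornology.IsBounded Ω)
    (hC1 : HasC1Boundary Ω)
    (hH : ContinuousOn (fun q : Space n × Space n => H q.1 q.2) (closure Ω ×ˢ univ))
    (hconv : ∀ x ∈ closure Ω, ConvexOn ℝ univ (H x))
    (hγ : Continuous γ) (hg : Continuous g) (hobl : IsOblique Ω γ)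
    (hφ : LipschitzOnWith K φ (closure Ω)) (hsup : IsSupersolution Ω H γ g 0 φ)
    {x₀ : Space n} (hx₀ : x₀ ∈ closure Ω) :
    ∃ (C M : ℝ) (Z : ℝ → State n) (R : ℝ≥0), LipschitzWith R Z ∧
      (∀ t ≤ 0, Z t = (x₀, 0, 0, 0)) ∧ (∀ t, 0 ≤ t → (Z t).1 ∈ closure Ω) ∧
      (∀ t, 0 < t → ∀ w, HasDerivAt Z w t → w ∈ velocitySet Ω H γ g C M (Z t).1) ∧
      ∀ t, 0 ≤ t → φ (Z t).1 + (Z t).2.2.2 ≤ φ x₀ := by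
  obtain ⟨C, hC⟩ := hsup.exists_velocity hΩ hbdd hC1 hH hconv hγ.continuousOn hg.continuousOn
    hobl hφ
  obtain ⟨c, hc, hν⟩ := hobl.exists_pos_le hΩ hbdd hC1 hγ.continuousOn
  obtain ⟨R, hR⟩ := exists_norm_le_of_mem_velocitySet (C := C) (M := |C| / c) (H := H) hbdd hγ hg
  let ε : ℕ → ℝ := fun k => 1 / ((k : ℝ) + 1)
  have hε : ∀ k, 0 < ε k := fun k => by positivity
  have hεt : Tendsto ε atTop (𝓝 0) := tendsto_one_div_add_atTop_nhds_zero_nat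
  have hex : ∀ k, ∃ (M : ℝ) (Z : ℝ → State n) (R : ℝ≥0), LipschitzWith R Z ∧
      (∀ t ≤ 0, Z t = (x₀, 0, 0, 0)) ∧ (∀ t, 0 ≤ t → (Z t).1 ∈ closure Ω) ∧
      (∀ t, 0 < t → ∀ w, HasDerivAt Z w t →
        w ∈ velocitySet Ω H γ (fun x => g x - ε k) C M (Z t).1) ∧
      ∀ t, 0 ≤ t → φ (Z t).1 + (Z t).2.2.2 ≤ φ x₀ := by
    intro k
    obtain ⟨M, hM⟩ := hC (ε k) (hε k)
    exact ⟨M, exists_trajectory_of_selection hΩ hbdd hH hγ (hg.sub continuous_const) hφ hM hx₀⟩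
  choose Mk Z L hZlip hZ0 hZcl hZder hZφ using hex
  -- shear the cost so that the velocities lie in the set for `g`
  let T : ℕ → State n →L[ℝ] State n := fun k =>
    (ContinuousLinearMap.fst ℝ _ _).prod (((ContinuousLinearMap.fst ℝ _ _).prod
      (((ContinuousLinearMap.fst ℝ _ _).prod (ContinuousLinearMap.snd ℝ ℝ ℝ +
        ε k • ContinuousLinearMap.fst ℝ _ _)).comp (ContinuousLinearMap.snd ℝ _ _))).comp
          (ContinuousLinearMap.snd ℝ _ _))
  have hT : ∀ k (ξ v : Space n) (l ζ : ℝ), T k (ξ, v, l, ζ) = (ξ, v, l, ζ + ε k * l) :=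
    fun k ξ v l ζ => by simp [T]
  let S : ℕ → State n →L[ℝ] State n := fun k =>
    (ContinuousLinearMap.fst ℝ _ _).prod (((ContinuousLinearMap.fst ℝ _ _).prod
      (((ContinuousLinearMap.fst ℝ _ _).prod (ContinuousLinearMap.snd ℝ ℝ ℝ -
        ε k • ContinuousLinearMap.fst ℝ _ _)).comp (ContinuousLinearMap.snd ℝ _ _))).comp
          (ContinuousLinearMap.snd ℝ _ _))
  have hST : ∀ k y, S k (T k y) = y := fun k y => by simp [S, T]
  have hTS : ∀ k y, T k (S k y) = y := fun k y => by simp [S, T]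
  let Y : ℕ → ℝ → State n := fun k t => T k (Z k t)
  have hY1 : ∀ k t, (Y k t).1 = (Z k t).1 := fun k t => rfl
  have hY0 : ∀ k t, t ≤ 0 → Y k t = (x₀, 0, 0, 0) := fun k t ht => by
    change T k (Z k t) = _
    rw [hZ0 k t ht, hT]; simp
  have hYlip : ∀ k, LipschitzWith (‖T k‖₊ * L k) (Y k) := fun k => (T k).lipschitz.comp (hZlip k)
  have hYder : ∀ k t, 0 < t → ∀ w, HasDerivAt (Y k) w t →
      w ∈ velocitySet Ω H γ g C (|C| / c) (Y k t).1 := by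
    intro k t ht w hw
    have hSw : HasDerivAt (Z k) (S k w) t := by
      have h1 := (S k).hasFDerivAt.comp_hasDerivAt t hw
      have h2 : (S k ∘ Y k) = Z k := funext fun t => hST k _
      rwa [h2] at h1
    obtain ⟨⟨ξ, v, l, ζ⟩, hw'⟩ : ∃ w', w' = S k w := ⟨_, rfl⟩
    have hwT : w = (ξ, v, l, ζ + ε k * l) := by rw [← hT, hw', hTS]
    rw [← hw'] at hSw
    obtain ⟨h1, h2, h3, h4, h5, h6, h7⟩ := hZder k t ht _ hSw
    dsimp only at h1 h2 h3 h4 h5 h6 h7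
    rw [hY1, hwT]
    refine ⟨h1, h2, h3, ?_, ?_, fun q => ?_, h7⟩
    · dsimp only
      -- Inside, `l = 0`. On the boundary tangency gives `l * ⟪ν, γ⟫ = ⟪ν, v⟫ ≤ |C|`, and
      -- obliqueness gives `l ≤ |C| / c`, whatever `ε k` is.
      rcases (closure_eq_self_union_frontier Ω ▸ hZcl k t ht.le :
        (Z k t).1 ∈ Ω ∪ frontier Ω) with hi | hf
      · rw [h7 hi]; positivity
      obtain ⟨ν, hν1, hν2⟩ := hν _ hf
      have h8 : HasDerivAt (fun s => (Z k s).1) ξ t := hSw.fst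
      have h9 := IsOuterUnitNormal.inner_deriv_eq_zero (X := fun s => (Z k s).1) hν1
        ((lt_mem_nhds ht).mono fun s hs => hZcl k s (le_of_lt hs)) h8
      rw [h1, inner_sub_right, real_inner_smul_right] at h9
      have h10 : ⟪ν, v⟫_ℝ ≤ |C| := by
        refine (real_inner_le_norm _ _).trans ?_
        rw [hν1.norm_eq_one, one_mul]
        exact h2.trans (le_abs_self C)
      rw [le_div_iff₀ hc]
      have h11 := mul_le_mul_of_nonneg_left hν2 h3
      linarith
    · dsimp only
      rwa [show ζ + ε k * l - g (Z k t).1 * l = ζ - (g (Z k t).1 - ε k) * l by ring]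
    · dsimp only
      linarith [h6 q]
  have hYR : ∀ k s t, 0 ≤ s → s ≤ t → ‖Y k t - Y k s‖ ≤ R * (t - s) := fun k s t hs hst =>
    norm_sub_le_of_hasDerivAt (hYlip k) hst fun τ hτ w hw =>
      hR _ (hZcl k τ (hs.trans hτ.1.le)) w (hYder k τ (hs.trans_lt hτ.1) w hw)
  have hYR' : ∀ k s t, ‖Y k t - Y k s‖ ≤ R * |t - s| := by
    intro k s t
    wlog hst : s ≤ t generalizing s t
    · rw [norm_sub_rev, abs_sub_comm]; exact this t s (le_of_not_ge hst)
    have hclamp : ∀ r, Y k r = Y k (max r 0) := by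
      intro r
      rcases le_total r 0 with hr | hr
      · rw [max_eq_right hr, hY0 k r hr, hY0 k 0 le_rfl]
      · rw [max_eq_left hr]
    rw [hclamp t, hclamp s]
    refine (hYR k _ _ (le_max_right _ _) (max_le_max_right 0 hst)).trans ?_
    refine mul_le_mul_of_nonneg_left ?_ R.2
    exact (le_abs_self _).trans (abs_max_sub_max_le_abs _ _ _)
  obtain ⟨Z', h1, h2, h3, h4, h5⟩ := exists_trajectory_velocitySet (C := C) (M := |C| / c) hΩ hbdd
    hH hγ hg Y (x₀, 0, 0, 0) R (fun _ => 0) tendsto_const_nhds hY0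
    (fun k s t => by simpa using hYR' k s t)
    (fun t ht δ hδ => .of_forall fun k => ⟨(Y k t).1, hZcl k t ht, by simpa using hδ.le⟩)
    (fun F a s t δ hs hst hδ => .of_forall fun k hyp => by
      refine (map_sub_le_of_ae_hasDerivAt (hYlip k) F hst fun τ hτ w hw => ?_).trans
        (le_add_of_nonneg_right hδ.le)
      exact hyp τ ⟨hτ.1.le, hτ.2⟩ (Y k τ).1 (hZcl k τ (hs.trans hτ.1.le))
        (by simpa using hδ.le) w (hYder k τ (hs.trans_lt hτ.1) w hw))
  refine ⟨C, |C| / c, Z', R, h1, h2, h3, h5, fun t ht => ?_⟩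
  have hU : (hyperfilter ℕ : Filter ℕ) ≤ atTop := by
    rw [← Nat.cofinite_eq_atTop]; exact hyperfilter_le_cofinite
  have hX : Tendsto (fun k => (Y k t).1) (hyperfilter ℕ) (𝓝[closure Ω] (Z' t).1) :=
    tendsto_nhdsWithin_iff.2 ⟨(continuous_fst.tendsto _).comp (h4 t),
      .of_forall fun k => hZcl k t ht⟩
  have hζ : Tendsto (fun k => (Y k t).2.2.2) (hyperfilter ℕ) (𝓝 (Z' t).2.2.2) :=
    ((continuous_snd.comp (continuous_snd.comp continuous_snd)).tendsto _).comp (h4 t)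
  have hlim1 := ((hφ.continuousOn _ (h3 t ht)).tendsto.comp hX).add hζ
  have hlim2 : Tendsto (fun k => φ x₀ + ε k * (R * t)) (hyperfilter ℕ) (𝓝 (φ x₀)) := by
    have := (hεt.mul_const ((R : ℝ) * t)).const_add (φ x₀)
    simp only [zero_mul, add_zero] at this
    exact this.mono_left hU
  refine le_of_tendsto_of_tendsto' hlim1 hlim2 fun k => ?_
  simp only [Function.comp_apply]
  have h6 := hZφ k t ht
  have h7 : (Y k t).2.2.2 = (Z k t).2.2.2 + ε k * (Z k t).2.2.1 := by
    change (T k (Z k t)).2.2.2 = _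
    simp [T]
  have h8 : (Z k t).2.2.1 ≤ R * t := by
    have h9 : (Z k t).2.2.1 = (Y k t - Y k 0).2.2.1 := by
      rw [hY0 k 0 le_rfl]
      change _ = (T k (Z k t) - _).2.2.1
      simp [T]
    have h10 := hYR k 0 t le_rfl ht
    rw [sub_zero] at h10
    rw [h9]
    refine (le_abs_self _).trans (le_trans ?_ h10)
    rw [← Real.norm_eq_abs]
    exact (norm_fst_le _).trans ((norm_snd_le _).trans (norm_snd_le _))
  have h11 := mul_le_mul_of_nonneg_left h8 (hε k).le
  rw [h7, hY1]
  linarith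

end Construction

/-! ### Extension of boundary data, and calibration -/

/-- Tietze extension makes `γ` and `g` continuous everywhere, as closedness of the velocity graph
requires. Their values inside are immaterial, since `l = 0` there. -/
theorem exists_continuous_eqOn_of_isClosed {s : Set (Space n)} (hs : IsClosed s) {V : Type}
    [TopologicalSpace V] [TietzeExtension.{0} V] {f : Space n → V} (hf : ContinuousOn f s) :
    ∃ f' : Space n → V, Continuous f' ∧ EqOn f' f s := by
  obtain ⟨f', hf'⟩ := ContinuousMap.exists_restrict_eq hs
    (⟨s.domRestrict f, continuousOn_iff_continuous_domRestrict.1 hf⟩ : C(s, V))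
  refine ⟨f', f'.continuous, fun x hx => ?_⟩
  exact DFunLike.congr_fun hf' ⟨x, hx⟩

theorem lipschitzWith_fst {α β τ : Type*} [PseudoEMetricSpace α] [PseudoEMetricSpace β]
    [PseudoEMetricSpace τ] {f : τ → α × β} {R : ℝ≥0} (hf : LipschitzWith R f) :
    LipschitzWith R fun t => (f t).1 := by
  have h : LipschitzWith (1 * R) fun t => (f t).1 := LipschitzWith.prod_fst.comp hf
  rwa [one_mul] at h

theorem lipschitzWith_snd {α β τ : Type*} [PseudoEMetricSpace α] [PseudoEMetricSpace β]
    [PseudoEMetricSpace τ] {f : τ → α × β} {R : ℝ≥0} (hf : LipschitzWith R f) :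
    LipschitzWith R fun t => (f t).2 := by
  have h : LipschitzWith (1 * R) fun t => (f t).2 := LipschitzWith.prod_snd.comp hf
  rwa [one_mul] at h

section Calibrated

variable {Ω : Set (Space n)} {H : Space n → Space n → ℝ} {γ γ' : Space n → Space n}
  {g g' φ : Space n → ℝ} {a : ℝ} {K : ℝ≥0}

theorem IsSubsolution.congr_boundary (h : IsSubsolution Ω H γ g a φ)
    (hγ : EqOn γ' γ (frontier Ω)) (hg : EqOn g' g (frontier Ω)) :
    IsSubsolution Ω H γ' g' a φ :=
  ⟨h.1, h.2, fun x hx ψ h1 h2 => by rw [hγ hx, hg hx]; exact h.3 x hx ψ h1 h2⟩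

theorem IsSupersolution.congr_boundary (h : IsSupersolution Ω H γ g a φ)
    (hγ : EqOn γ' γ (frontier Ω)) (hg : EqOn g' g (frontier Ω)) :
    IsSupersolution Ω H γ' g' a φ :=
  ⟨h.1, h.2, fun x hx ψ h1 h2 => by rw [hγ hx, hg hx]; exact h.3 x hx ψ h1 h2⟩

theorem lagrangian_le_iff {x ξ : Space n} {r : ℝ} :
    lagrangian H x ξ ≤ (r : EReal) ↔ ∀ q, ⟪ξ, q⟫_ℝ - H x q ≤ r := by
  simp only [lagrangian, iSup_le_iff, EReal.coe_le_coe_iff]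

/-- A real number which is an upper bound for the affine functions defining the Lagrangian and is
a lower bound for all such bounds is the Lagrangian. -/
theorem lagrangian_eq_of_isLeast {x ξ : Space n} {r : ℝ} (h : ∀ q, ⟪ξ, q⟫_ℝ - H x q ≤ r)
    (hr : ∀ r', (∀ q, ⟪ξ, q⟫_ℝ - H x q ≤ r') → r ≤ r') : lagrangian H x ξ = (r : EReal) := by
  have hle : lagrangian H x ξ ≤ (r : EReal) := lagrangian_le_iff.2 h
  have hbot : lagrangian H x ξ ≠ ⊥ := by
    intro hb
    have h1 : ((⟪ξ, (0 : Space n)⟫_ℝ - H x 0 : ℝ) : EReal) ≤ lagrangian H x ξ :=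
      le_iSup (fun p : Space n => ((⟪ξ, p⟫_ℝ - H x p : ℝ) : EReal)) 0
    rw [hb, le_bot_iff] at h1
    exact EReal.coe_ne_bot _ h1
  have htop : lagrangian H x ξ ≠ ⊤ := ne_top_of_le_ne_top (EReal.coe_ne_top r) hle
  refine le_antisymm hle ?_
  rw [← EReal.coe_toReal htop hbot, EReal.coe_le_coe_iff]
  refine hr _ (lagrangian_le_iff.1 ?_)
  rw [EReal.coe_toReal htop hbot]

/-- Along a trajectory on which a solution `φ` decreases at least at the rate of the cost, the cost
is the running cost, and `φ` decreases exactly at this rate. -/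
theorem IsSubsolution.lagrangian_eq_of_trajectory (hΩ : IsOpen Ω) (hbdd : Bornology.IsBounded Ω)
    (hC1 : HasC1Boundary Ω)
    (hH : ContinuousOn (fun q : Space n × Space n => H q.1 q.2) (closure Ω ×ˢ univ))
    (hγ : Continuous γ) (hg : Continuous g) (hobl : IsOblique Ω γ)
    (hφ : LipschitzOnWith K φ (closure Ω)) (hsub : IsSubsolution Ω H γ g 0 φ)
    {x₀ : Space n} (hx₀ : x₀ ∈ closure Ω) {C M : ℝ} {Z : ℝ → State n} {R : ℝ≥0}
    (hZ : LipschitzWith R Z) (hZ0 : ∀ t ≤ 0, Z t = (x₀, 0, 0, 0))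
    (hZcl : ∀ t, 0 ≤ t → (Z t).1 ∈ closure Ω)
    (hZder : ∀ t, 0 < t → ∀ w, HasDerivAt Z w t → w ∈ velocitySet Ω H γ g C M (Z t).1)
    (hZφ : ∀ t, 0 ≤ t → φ (Z t).1 + (Z t).2.2.2 ≤ φ x₀) :
    (∀ t, 0 ≤ t → φ (Z t).1 + (Z t).2.2.2 = φ x₀) ∧
    ∀ᵐ t, 0 < t → ∀ w, HasDerivAt Z w t →
      lagrangian H (Z t).1 (-w.2.1) = ((w.2.2.2 - g (Z t).1 * w.2.2.1 : ℝ) : EReal) := by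
  -- The trajectory rests at `x₀` for negative times, so all estimates may be made on the whole
  -- line.
  have hcl : ∀ t, (Z t).1 ∈ closure Ω := fun t => by
    rcases le_total 0 t with ht | ht
    · exact hZcl t ht
    · rw [hZ0 t ht]; exact hx₀
  have hX : LipschitzWith R fun t => (Z t).1 :=
    lipschitzWith_fst hZ
  have hD : LipschitzWith (K * R) fun t => φ (Z t).1 := by
    have h1 := hφ.comp (hX.lipschitzOnWith (s := univ)) fun t _ => hcl t
    exact lipschitzOnWith_univ.1 h1
  have hζ : LipschitzWith R fun t => (Z t).2.2.2 :=
    lipschitzWith_snd (lipschitzWith_snd (lipschitzWith_snd hZ))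
  have hW : LipschitzWith (K * R + R) fun t => φ (Z t).1 + (Z t).2.2.2 := hD.add hζ
  have hrate : ∀ t, 0 < t → ∀ w d r, HasDerivAt Z w t → HasDerivAt (fun s => φ (Z s).1) d t →
      (∀ q, ⟪-w.2.1, q⟫_ℝ - H (Z t).1 q ≤ r) → -d ≤ r + g (Z t).1 * w.2.2.1 := by
    intro t ht w d r hw hd hr
    obtain ⟨h1, -, h3, -, -, -, h7⟩ := hZder t ht w hw
    refine hsub.neg_deriv_le hΩ hbdd hC1 hH hγ.continuousOn hg.continuousOn hobl hφ
      (X := fun s => (Z s).1) (.of_forall hcl) ?_ hd h3 h7 hr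
    rw [← h1]
    exact hw.fst
  have hmono : ∀ t, 0 ≤ t → φ x₀ ≤ φ (Z t).1 + (Z t).2.2.2 := by
    intro t ht
    have h1 := sub_le_of_ae_deriv_le (c := 0) hW.neg ht (by
      filter_upwards [hZ.ae_differentiableAt_real, hD.ae_differentiableAt_real] with s hs1 hs2 hs
      have h2 := hs1.hasDerivAt
      have h3 : HasDerivAt (fun s => (Z s).2.2.2) (deriv Z s).2.2.2 s := h2.snd.snd.snd
      have h4 : HasDerivAt (-fun t => φ (Z t).1 + (Z t).2.2.2) _ s :=
        (hs2.hasDerivAt.add h3).neg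
      rw [h4.deriv]
      have h5 := hrate s hs.1 _ _ ((deriv Z s).2.2.2 - g (Z s).1 * (deriv Z s).2.2.1) h2
        hs2.hasDerivAt (by
          intro q
          obtain ⟨-, -, -, -, -, h6, -⟩ := hZder s hs.1 _ h2
          linarith [h6 q])
      linarith)
    simp only [Pi.neg_apply, hZ0 0 le_rfl] at h1
    linarith
  have heq : ∀ t, 0 ≤ t → φ (Z t).1 + (Z t).2.2.2 = φ x₀ := fun t ht =>
    le_antisymm (hZφ t ht) (hmono t ht)
  refine ⟨heq, ?_⟩
  filter_upwards [hD.ae_differentiableAt_real] with t hDt ht w hw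
  obtain ⟨-, -, -, -, -, h6, -⟩ := hZder t ht _ hw
  have h3 : HasDerivAt (fun s => (Z s).2.2.2) w.2.2.2 t := hw.snd.snd.snd
  have h4 : deriv (fun s => φ (Z s).1) t = -w.2.2.2 := by
    have h5 : HasDerivAt (fun s => φ x₀ - (Z s).2.2.2) (-w.2.2.2) t := h3.const_sub _
    have h7 : (fun s => φ (Z s).1) =ᶠ[𝓝 t] fun s => φ x₀ - (Z s).2.2.2 := by
      filter_upwards [lt_mem_nhds ht] with s hs
      linarith [heq s (le_of_lt hs)]
    exact (h5.congr_of_eventuallyEq h7).deriv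
  -- Constancy of `φ` plus cost identifies the cost rate with `-d`, and the subsolution rate then
  -- bounds it by `r + g l` for every admissible `r`.
  refine lagrangian_eq_of_isLeast (fun q => by linarith [h6 q]) fun r hr => ?_
  have := hrate t ht w _ r hw hDt.hasDerivAt hr
  rw [h4] at this
  linarith

end Calibrated

end NeumannHJ

end

/-! ### Assembly of the calibrated triple -/

theorem theorem7p3 {n : ℕ} (Ω : Set (NeumannHJ.Space n)) (hΩ_open : IsOpen Ω)
    (hΩ_conn : IsConnected Ω) (hΩ_bdd : Bornology.IsBounded Ω)
    (hΩ_C1 : NeumannHJ.HasC1Boundary Ω)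
    (H : NeumannHJ.Space n → NeumannHJ.Space n → ℝ)
    (γ : NeumannHJ.Space n → NeumannHJ.Space n) (g : NeumannHJ.Space n → ℝ)
    (hH_cont : ContinuousOn (fun q : NeumannHJ.Space n × NeumannHJ.Space n => H q.1 q.2)
      (closure Ω ×ˢ Set.univ))
    (hγ_cont : ContinuousOn γ (frontier Ω)) (hg_cont : ContinuousOn g (frontier Ω))
    (hH_convex : ∀ x ∈ closure Ω, ConvexOn ℝ Set.univ (H x))
    (hH_coercive : ∀ x ∈ closure Ω,
      Filter.Tendsto (H x) (Filter.cocompact (NeumannHJ.Space n)) Filter.atTop)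
    (hγ_oblique : NeumannHJ.IsOblique Ω γ)
    (φ : NeumannHJ.Space n → ℝ) (hφ_lip : ∃ K : ℝ≥0, LipschitzOnWith K φ (closure Ω))
    (hφ_sol : NeumannHJ.IsSolution Ω H γ g 0 φ)
    (x : NeumannHJ.Space n) (hx : x ∈ closure Ω) :
    ∃ (η v : ℝ → NeumannHJ.Space n) (l : ℝ → ℝ),
      NeumannHJ.SP Ω γ x η v l ∧
      NeumannHJ.IsCalibrated H g φ η v l ∧
      (∃ K : ℝ≥0, LipschitzOnWith K η (Set.Ici 0)) ∧
      MeasureTheory.MemLp v ∞ (MeasureTheory.volume.restrict (Set.Ici (0 : ℝ))) ∧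
      MeasureTheory.MemLp l ∞ (MeasureTheory.volume.restrict (Set.Ici (0 : ℝ))) := by
  obtain ⟨K, hφ⟩ := hφ_lip
  have : TietzeExtension.{0} (NeumannHJ.Space n) := TietzeExtension.of_tvs ℝ
  obtain ⟨γ', hγ', hγe⟩ := NeumannHJ.exists_continuous_eqOn_of_isClosed isClosed_frontier hγ_cont
  obtain ⟨g', hg', hge⟩ := NeumannHJ.exists_continuous_eqOn_of_isClosed isClosed_frontier hg_cont
  have hobl : NeumannHJ.IsOblique Ω γ' := fun z hz ν hν => by rw [hγe hz]; exact hγ_oblique z hz ν hν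
  have hsub := hφ_sol.1.congr_boundary hγe hge
  have hsup := hφ_sol.2.congr_boundary hγe hge
  obtain ⟨C, M, Z, R, hZ, hZ0, hZcl, hZder, hZφ⟩ := hsup.exists_trajectory hΩ_open hΩ_bdd hΩ_C1
    hH_cont hH_convex hγ' hg' hobl hφ hx
  obtain ⟨hbal, hlag⟩ := hsub.lagrangian_eq_of_trajectory hΩ_open hΩ_bdd hΩ_C1 hH_cont hγ' hg'
    hobl hφ hx hZ hZ0 hZcl hZder hZφ
  have hX : LipschitzWith R fun t => (Z t).1 :=
    NeumannHJ.lipschitzWith_fst hZ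
  have hV : LipschitzWith R fun t => (Z t).2.1 :=
    NeumannHJ.lipschitzWith_fst (NeumannHJ.lipschitzWith_snd hZ)
  have hΛ : LipschitzWith R fun t => (Z t).2.2.1 :=
    NeumannHJ.lipschitzWith_fst (NeumannHJ.lipschitzWith_snd (NeumannHJ.lipschitzWith_snd hZ))
  have hζ : LipschitzWith R fun t => (Z t).2.2.2 :=
    NeumannHJ.lipschitzWith_snd (NeumannHJ.lipschitzWith_snd (NeumannHJ.lipschitzWith_snd hZ))
  -- The controls are recovered as derivatives of state components. The default value `0` at points
  -- of nondifferentiability keeps them measurable and bounded everywhere.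
  obtain ⟨v, hv⟩ : ∃ v, v = deriv fun t => (Z t).2.1 := ⟨_, rfl⟩
  obtain ⟨l, hl⟩ : ∃ l, l = deriv fun t => (Z t).2.2.1 := ⟨_, rfl⟩
  obtain ⟨ζ, hζd⟩ : ∃ ζ, ζ = deriv fun t => (Z t).2.2.2 := ⟨_, rfl⟩
  have hvm : StronglyMeasurable v := hv ▸ stronglyMeasurable_deriv _
  have hlm : StronglyMeasurable l := hl ▸ stronglyMeasurable_deriv _
  have hvb : ∀ t, ‖v t‖ ≤ R := fun t => hv ▸ norm_deriv_le_of_lipschitz hV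
  have hlb : ∀ t, ‖l t‖ ≤ R := fun t => hl ▸ norm_deriv_le_of_lipschitz hΛ
  have hmain : ∀ᵐ t ∂(volume.restrict (Ici (0 : ℝ))), HasDerivAt (fun s => (Z s).1)
      (v t - l t • γ (Z t).1) t ∧ 0 ≤ l t ∧ ((Z t).1 ∈ Ω → l t = 0) ∧
      g' (Z t).1 * l t = g (Z t).1 * l t ∧
      NeumannHJ.lagrangian H (Z t).1 (-v t) = ((ζ t - g' (Z t).1 * l t : ℝ) : EReal) := by
    -- The inclusion is known only for positive times; the endpoint is a null set.
    rw [← restrict_Ioi_eq_restrict_Ici, ae_restrict_iff' measurableSet_Ioi]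
    filter_upwards [hlag, hZ.ae_differentiableAt_real] with t h1 h2 ht
    have hd := h2.hasDerivAt
    have hvt : v t = (deriv Z t).2.1 := by
      rw [hv]; exact (show HasDerivAt (fun t => (Z t).2.1) _ t from hd.snd.fst).deriv
    have hlt : l t = (deriv Z t).2.2.1 := by
      rw [hl]; exact (show HasDerivAt (fun t => (Z t).2.2.1) _ t from hd.snd.snd.fst).deriv
    have hζt : ζ t = (deriv Z t).2.2.2 := by
      rw [hζd]; exact (show HasDerivAt (fun t => (Z t).2.2.2) _ t from hd.snd.snd.snd).deriv
    have h3 := h1 ht _ hd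
    obtain ⟨h4, -, h5, -, -, -, h6⟩ := hZder t ht _ hd
    rw [← hvt, ← hlt, ← hζt] at h3
    rw [← hvt, ← hlt] at h4
    rw [← hlt] at h5 h6
    rcases (closure_eq_self_union_frontier Ω ▸ hZcl t (le_of_lt ht) :
      (Z t).1 ∈ Ω ∪ frontier Ω) with hi | hf
    -- Inside `Ω` the original and extended data may differ, but both are multiplied by `l t = 0`.
    · refine ⟨?_, h5, h6, by rw [h6 hi]; simp, h3⟩
      rw [h6 hi, zero_smul] at h4 ⊢
      rw [← h4]; exact hd.fst
    · refine ⟨?_, h5, h6, by rw [hge hf], h3⟩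
      rw [← hγe hf, ← h4]; exact hd.fst
  have hres : ∀ {t : ℝ}, Icc 0 t ⊆ Ici (0 : ℝ) := fun {t} s hs => hs.1
  have hζint : ∀ t : ℝ, 0 < t → IntegrableOn ζ (Icc 0 t) ∧
      ∫ s in (0 : ℝ)..t, ζ s = (Z t).2.2.2 := by
    intro t ht
    have hac : AbsolutelyContinuousOnInterval (fun s => (Z s).2.2.2) 0 t :=
      (hζ.lipschitzOnWith (s := uIcc 0 t)).absolutelyContinuousOnInterval
    refine ⟨?_, ?_⟩
    · rw [integrableOn_Icc_iff_integrableOn_Ioc, ← intervalIntegrable_iff_integrableOn_Ioc_of_le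
        ht.le, hζd]
      exact hac.intervalIntegrable_deriv
    · rw [hζd, hac.integral_deriv_eq_sub, hZ0 0 le_rfl, sub_zero]
  have hbddint : ∀ {V : Type} [NormedAddCommGroup V] {f : ℝ → V} (T : ℝ), StronglyMeasurable f →
      (∀ t, ‖f t‖ ≤ R) → IntegrableOn f (Icc 0 T) := fun T hm hb =>
    Measure.integrableOn_of_bounded measure_Icc_lt_top.ne hm.aestronglyMeasurable
      (.of_forall hb)
  refine ⟨fun t => (Z t).1, v, l, ⟨?_, ?_, ?_, ?_, hZcl, ?_, ?_, ?_⟩, ?_,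
    ⟨R, hX.lipschitzOnWith⟩, ?_, ?_⟩
  · exact fun T _ => (hX.lipschitzOnWith (s := uIcc 0 T)).absolutelyContinuousOnInterval
  · exact fun T _ => hbddint T hvm hvb
  · exact fun T _ => hbddint T hlm hlb
  · simp only [hZ0 0 le_rfl]
  · exact hmain.mono fun t ht => ht.1
  · exact hmain.mono fun t ht => ht.2.1
  · exact hmain.mono fun t ht => ht.2.2.1
  · intro t ht
    have hmt := ae_restrict_of_ae_restrict_of_subset (hres (t := t)) hmain
    obtain ⟨hζi, hζe⟩ := hζint t ht
    have hgl' : IntegrableOn (fun s => g' (Z s).1 * l s) (Icc 0 t) :=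
      (hbddint t hlm hlb).continuousOn_mul (hg'.comp hX.continuous).continuousOn isCompact_Icc
    refine ⟨?_, ?_, ?_, ?_⟩
    · filter_upwards [hmt] with s hs
      rw [hs.2.2.2.2]
      exact EReal.coe_ne_top _
    · refine (hζi.sub hgl').congr ?_
      filter_upwards [hmt] with s hs
      rw [hs.2.2.2.2, EReal.toReal_coe]
      rfl
    · refine hgl'.congr ?_
      filter_upwards [hmt] with s hs using hs.2.2.2.1
    · have h1 : ∫ s in (0 : ℝ)..t, NeumannHJ.runningCost H g (fun t => (Z t).1) v l s =
          ∫ s in (0 : ℝ)..t, ζ s := by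
        rw [intervalIntegral.integral_of_le ht.le, intervalIntegral.integral_of_le ht.le]
        refine integral_congr_ae ?_
        filter_upwards [ae_restrict_of_ae_restrict_of_subset Ioc_subset_Icc_self hmt] with s hs
        simp only [NeumannHJ.runningCost]
        rw [hs.2.2.2.2, EReal.toReal_coe, ← hs.2.2.2.1]
        ring
      rw [h1, hζe]
      simp only [hZ0 0 le_rfl]
      linarith [hbal t ht.le]
  · exact memLp_top_of_bound hvm.aestronglyMeasurable R (.of_forall hvb)
  · exact memLp_top_of_bound hlm.aestronglyMeasurable R (.of_forall hlb)
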